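/- Let $\mathcal G_L$ be a Lie group, finite- or infinite-dimensional, modelled on a Hausdorff real locally convex topological vector space $E$ (smoothness is understood in the sense of Michal--Bastiani: a map between open subsets of such spaces is $C^\infty$ if all its iterated directional derivatives exist and are continuous). Let $e$ be its identity and $\mathfrak g_L=T_e\mathcal G_L$ its Lie algebra, the bracket being that of left invariant vector fields. Let $\mathcal G\subset\mathcal G_L$ be an arbitrary subgroup. A vector $X\in\mathfrak g_L$ is called \emph{tangent} to $\mathcal G$ if there are an open interval $I\ni 0$, a curve $\varphi\colon I\to\mathcal G_L$ that is $C^\infty$ as a curve in $\mathcal G_L$, and an integer $k\ge 1$ such that $\varphi_t\in\mathcal G$ for all $t\in I$, $\varphi_0=e$, the derivatives of $\varphi$ at $t=0$ of orders $1,\dots,k-1$ vanish, and $\varphi^{(k)}(0)=X$ (that is, $\varphi$ is a $k$-th order integral curve of $X$). Let $\mathcal T_o\mathcal G$ be the set of all vectors tangent to $\mathcal G$. Then: (1) $\mathcal T_o\mathcal G$ is a Lie subalgebra of $\mathfrak g_L$. (2) Suppose that $E$ is normable (for instance $\mathcal G_L$ is finite-dimensional or a Banach--Lie group), or that $\mathcal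 G_L$ is a regular Lie group in the sense of Milnor; of the latter only the following is needed: the evolution map, which sends the left logarithmic derivative $u=\gamma^{-1}\gamma'\colon[0,1]\to\mathfrak g_L$ of a smooth curve $\gamma$ in $\mathcal G_L$ with $\gamma(0)=e$ to $\gamma(1)$, is continuous at $u=0$ for the topology of uniform convergence of all derivatives on $[0,1]$. Let $\exp X=\gamma_X(1)$, where $\gamma_X$ is the smooth one-parameter subgroup of $\mathcal G_L$ with $\gamma_X'(0)=X$ (which is unique, and exists for every $X$ if $\mathcal G_L$ is finite-dimensional, Banach or regular; vectors $X$ without such a subgroup, if any, are disregarded). Then the group $\langle\exp(\mathcal T_o\mathcal G)\rangle$ generated by the exponential image of $\mathcal T_o\mathcal G$ is a subgroup of the topological closure $\overline{\mathcal G}$ of $\mathcal G$ in $\mathcal G_L$. -/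

import Mathlib

open Set Filter Topology

namespace LCLie

/-! ### Differential calculus in real topological vector spaces (Michal–Bastiani) -/

section Calculus

universe u v

/-- `w` is the derivative of `f` at `x` in the direction `v`, i.e. the limit of
`(f (x + t v) - f x) / t` as `t → 0`, `t ≠ 0`. -/
def HasDirDeriv {E : Type u} [AddCommGroup E] [Module ℝ E]
    {F : Type v} [AddCommGroup F] [Module ℝ F] [TopologicalSpace F]
    (f : E → F) (x v : E) (w : F) : Prop :=
  Tendsto (fun t : ℝ => t⁻¹ • (f (x + t • v) - f x)) (𝓝[≠] 0) (𝓝 w)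

/-- The derivative of `f` at `x` in the direction `v` (meaningful when the limit exists and `F` is
Hausdorff). -/
noncomputable def dirDeriv {E : Type u} [AddCommGroup E] [Module ℝ E]
    {F : Type v} [AddCommGroup F] [Module ℝ F] [TopologicalSpace F]
    (f : E → F) (x v : E) : F :=
  limUnder (𝓝[≠] (0 : ℝ)) (fun t : ℝ => t⁻¹ • (f (x + t • v) - f x))

/-- The derivative `c'` of a curve `c : ℝ → F`. -/
noncomputable def curveDeriv {F : Type v} [AddCommGroup F] [Module ℝ F] [TopologicalSpace F]
    (c : ℝ → F) : ℝ → F :=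
  fun t => dirDeriv c t 1

/-- `f` is of class `C^n` on the open set `U`, in the sense of Michal–Bastiani: `f` is continuous
on `U`, and for `n ≥ 1` all directional derivatives `df (x, v)`, `x ∈ U`, `v ∈ E`, exist and
`df` is of class `C^(n-1)` on `U × E`. -/
def CnOn : ℕ → ∀ {E : Type u} [AddCommGroup E] [Module ℝ E] [TopologicalSpace E]
    {F : Type v} [AddCommGroup F] [Module ℝ F] [TopologicalSpace F], (E → F) → Set E → Prop
  | 0, _, _, _, _, _, _, _, _, f, U => ContinuousOn f U
  | n + 1, E, _, _, _, F, _, _, _, f, U => ContinuousOn f U ∧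
      ∃ df : E × E → F, (∀ x ∈ U, ∀ v : E, HasDirDeriv f x v (df (x, v))) ∧
        CnOn n df (U ×ˢ (univ : Set E))

/-- `f` is smooth (of class `C^∞`) on the open set `U`, in the sense of Michal–Bastiani. -/
def SmoothOn {E : Type u} [AddCommGroup E] [Module ℝ E] [TopologicalSpace E]
    {F : Type v} [AddCommGroup F] [Module ℝ F] [TopologicalSpace F]
    (f : E → F) (U : Set E) : Prop :=
  ∀ n : ℕ, CnOn n f U

end Calculus

/-! ### Lie groups modelled on locally convex spaces -/

/-- `G` is a Lie group modelled on the topological vector space `E`: a topological group with an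
`E`-valued atlas whose changes of charts are smooth and for which multiplication and inversion are
smooth when read in charts. -/
class LieGroup (E : Type*) [AddCommGroup E] [Module ℝ E] [TopologicalSpace E]
    (G : Type*) [TopologicalSpace G] [ChartedSpace E G] [Group G] : Prop
    extends IsTopologicalGroup G where
  smooth_chart_change : ∀ e ∈ atlas E G, ∀ e' ∈ atlas E G,
    SmoothOn (fun x : E => e' (e.symm x)) (e.target ∩ e.symm ⁻¹' e'.source)
  smooth_mul : ∀ e₁ ∈ atlas E G, ∀ e₂ ∈ atlas E G, ∀ e₃ ∈ atlas E G,
    SmoothOn (fun p : E × E => e₃ (e₁.symm p.1 * e₂.symm p.2))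
      ((e₁.target ×ˢ e₂.target) ∩ {p : E × E | e₁.symm p.1 * e₂.symm p.2 ∈ e₃.source})
  smooth_inv : ∀ e ∈ atlas E G, ∀ e' ∈ atlas E G,
    SmoothOn (fun x : E => e' (e.symm x)⁻¹) (e.target ∩ {x : E | (e.symm x)⁻¹ ∈ e'.source})

section LieGroup

variable (E : Type*) [AddCommGroup E] [Module ℝ E] [TopologicalSpace E]
  (G : Type*) [TopologicalSpace G] [ChartedSpace E G] [Group G]

/-- The tangent space `T_e G`, identified with the model space `E` through the preferred chart
at the identity. -/
abbrev LieAlg (_E : Type*) (_G : Type*) : Type _ := _E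

variable {E G}

/-- The left invariant vector field with value `X` at the identity, read in the preferred chart
at the identity: at the point with coordinate `x` it is the derivative at `s = 0` of
`g ↦ x · (e + s X)`. -/
noncomputable def leftInvariantField (X : LieAlg E G) (x : E) : E :=
  dirDeriv (fun y : E => chartAt E (1 : G)
      ((chartAt E (1 : G)).symm x * (chartAt E (1 : G)).symm y))
    (chartAt E (1 : G) 1) X

/-- The Lie bracket of `T_e G`: the value at the identity of the Lie bracket
`[V, W](x) = dW(x)(V(x)) - dV(x)(W(x))` of the left invariant vector fields `V`, `W` with values
`X`, `Y` at the identity. -/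
noncomputable def lieBracket (X Y : LieAlg E G) : LieAlg E G :=
  dirDeriv (leftInvariantField (E := E) (G := G) Y) (chartAt E (1 : G) 1) X -
    dirDeriv (leftInvariantField (E := E) (G := G) X) (chartAt E (1 : G) 1) Y

variable (E) in
/-- The curve `φ` is smooth on the open set `I ⊆ ℝ`. -/
def SmoothCurveOn (φ : ℝ → G) (I : Set ℝ) : Prop :=
  ContinuousOn φ I ∧ ∀ e ∈ atlas E G, SmoothOn (fun t : ℝ => e (φ t)) (I ∩ φ ⁻¹' e.source)

/-- `φ`, defined near `0` with `φ 0 = 1`, is a `k`-th order integral curve of `X`: the derivatives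
of orders `1, …, k - 1` vanish at `0` and the derivative of order `k` is `X`. -/
def IsIntegralCurveOfOrder (k : ℕ) (φ : ℝ → G) (X : LieAlg E G) : Prop :=
  (∀ j : ℕ, 1 ≤ j → j < k → curveDeriv^[j] (fun t : ℝ => chartAt E (1 : G) (φ t)) 0 = 0) ∧
    curveDeriv^[k] (fun t : ℝ => chartAt E (1 : G) (φ t)) 0 = X

variable (E) in
/-- The set of vectors `X` of `T_e G` that are tangent to the subgroup `H`: there are an open
interval `I` around `0`, a curve `φ : I → G`, smooth in `G`, with values in `H` and with `φ 0 = 1`,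
and some `k ≥ 1`, such that `φ` is a `k`-th order integral curve of `X`. -/
def tangentSet (H : Subgroup G) : Set (LieAlg E G) :=
  {X | ∃ (a b : ℝ) (φ : ℝ → G) (k : ℕ), a < 0 ∧ 0 < b ∧ 1 ≤ k ∧
    SmoothCurveOn E φ (Ioo a b) ∧ (∀ t ∈ Ioo a b, φ t ∈ H) ∧ φ 0 = 1 ∧
    IsIntegralCurveOfOrder k φ X}

/-- `γ` is a smooth one-parameter subgroup of `G` with initial velocity `X`. -/
def IsOneParameterSubgroup (γ : ℝ → G) (X : LieAlg E G) : Prop :=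
  SmoothCurveOn E γ univ ∧ (∀ s t : ℝ, γ (s + t) = γ s * γ t) ∧
    HasDirDeriv (fun t : ℝ => chartAt E (1 : G) (γ t)) 0 1 X

open Classical in
/-- The exponential map: `exp X = γ 1`, where `γ` is the (unique) smooth one-parameter subgroup
with initial velocity `X`. Where there is no such subgroup the exponential of `X` is not defined,
and the value here is `1`. -/
noncomputable def lieExp (X : LieAlg E G) : G :=
  if h : ∃ γ : ℝ → G, IsOneParameterSubgroup γ X then h.choose 1 else 1

variable (E) in
/-- The left logarithmic derivative `γ(t)⁻¹ · γ'(t) ∈ T_e G` of a curve in `G`. -/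
noncomputable def leftLogDeriv (γ : ℝ → G) (t : ℝ) : LieAlg E G :=
  dirDeriv (fun s : ℝ => chartAt E (1 : G) ((γ t)⁻¹ * γ s)) t 1

variable (E G) in
/-- The evolution map, which sends the left logarithmic derivative `u : [0, 1] → T_e G` of a smooth
curve `γ` with `γ 0 = 1` to `γ 1`, is continuous at `u = 0` for the `C^∞`-topology (uniform
convergence on `[0, 1]` of all derivatives): for every neighbourhood `U` of `1` there are `m` and
a neighbourhood `V` of `0` such that `γ 1 ∈ U` as soon as the derivatives up to order `m` of the
logarithmic derivative of `γ` take values in `V` on `[0, 1]`. This holds in every regular Lie group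
in the sense of Milnor, where moreover each smooth `u` has an evolution and the evolution map is
smooth. -/
def ContinuousEvolution : Prop :=
  ∀ U ∈ 𝓝 (1 : G), ∃ m : ℕ, ∃ V ∈ 𝓝 (0 : E), ∀ γ : ℝ → G,
    SmoothCurveOn E γ univ → γ 0 = 1 →
    (∀ j ≤ m, ∀ t ∈ Icc (0 : ℝ) 1, curveDeriv^[j] (leftLogDeriv E γ) t ∈ V) → γ 1 ∈ U

end LieGroup

/-- The topology of `E` is given by a single (semi)norm, as it is when `E` is finite-dimensional
or a Banach space. -/
def Normable (E : Type*) [AddCommGroup E] [Module ℝ E] [TopologicalSpace E] : Prop :=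
  ∃ p : Seminorm ℝ E, WithSeminorms (fun _ : Unit => p)

end LCLie

set_option linter.unusedSectionVars false

namespace LCLie

/-! ### Directional derivatives and the mean value theorem in locally convex spaces. -/

section Calculus

universe u v w

variable {E : Type u} [AddCommGroup E] [Module ℝ E] [TopologicalSpace E]
  [IsTopologicalAddGroup E] [ContinuousSMul ℝ E]
  {F : Type v} [AddCommGroup F] [Module ℝ F] [TopologicalSpace F]

/-! In the chart κ at the identity, with e = κ(1), a smooth germ φ through 1 has leading coefficient
R at order k if κ(φ(t)) = e + t^k (R + o(1)). By Taylor's formula this is the condition on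
derivatives that defines tangent vectors, up to the factor k!, which a linear change of time
absorbs. Tangent vectors are therefore exactly the leading coefficients of smooth germs with values
in H (`mem_tangentSet_iff`). Products of germs, brought to a common order by t ↦ t^m, add leading
coefficients; inverses negate them; changing time scales them by positive factors; commutators give
brackets, the orders adding up (`Lead.commutator`). This proves that the tangent set is a Lie
subalgebra.

For the closure statement, let γ be the one-parameter subgroup of a tangent vector X. The germ φ
that represents X agrees with γ(t^k) only to leading order. A triple jump ψ(at)ψ(at)ψ(bt)⁻¹ with
suitable a, b keeps the approximation of γ(t^k) and cancels the next error term, so γ(t^k) is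
approximated to any order p by germs in H (`IsLeadingIn.exists_approx`). With τ^k = σ/n, the element
ψ(τ)^n γ(σ)⁻¹ is a product of n conjugates of the small error ψ(τ)γ(σ/n)⁻¹. It remains to know that
a product of n factors of size O(n⁻ᴺ) is close to 1 for some N; this is `ProductsSmall`.

If E is normable, N = 1 suffices, by a one-seminorm estimate on the multiplication in the chart. If
the evolution map is continuous at 0, the product is the endpoint of a smooth path made of n short
pieces. Speeding up the pieces multiplies the i-th derivative of the logarithmic derivative by
n^(i+1), so N = m + 1 compensates the m derivatives that continuity involves.

The analytic tool throughout is strict differentiability (`tendsto_diffQuot`), which follows from a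
mean value theorem obtained by Hahn–Banach. -/

theorem HasDirDeriv.dirDeriv_eq [T2Space F] {f : E → F} {x v : E} {w : F}
    (h : HasDirDeriv f x v w) : dirDeriv f x v = w :=
  Tendsto.limUnder_eq h

theorem tendsto_add_smul (x v : E) : Tendsto (fun t : ℝ => x + t • v) (𝓝[≠] 0) (𝓝 x) := by
  have : Continuous fun t : ℝ => x + t • v := by fun_prop
  simpa using (this.tendsto 0).mono_left nhdsWithin_le_nhds

theorem HasDirDeriv.congr {f g : E → F} {x v : E} {w : F}
    (h : HasDirDeriv f x v w) (hfg : ∀ᶠ y in 𝓝 x, f y = g y) : HasDirDeriv g x v w := by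
  refine Tendsto.congr' ?_ h
  filter_upwards [(tendsto_add_smul x v).eventually hfg] with t ht
  rw [ht, hfg.self_of_nhds]

theorem dirDeriv_congr {f g : E → F} {x : E} (hfg : ∀ᶠ y in 𝓝 x, f y = g y) (v : E) :
    dirDeriv f x v = dirDeriv g x v := by
  have : (fun t : ℝ => t⁻¹ • (f (x + t • v) - f x)) =ᶠ[𝓝[≠] 0]
      fun t : ℝ => t⁻¹ • (g (x + t • v) - g x) := by
    filter_upwards [(tendsto_add_smul x v).eventually hfg] with t ht
    rw [ht, hfg.self_of_nhds]
  unfold dirDeriv limUnder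
  rw [Filter.map_congr this]

theorem HasDirDeriv.smul_dir [IsTopologicalAddGroup F] [ContinuousSMul ℝ F]
    {f : E → F} {x v : E} {w : F}
    (h : HasDirDeriv f x v w) (c : ℝ) : HasDirDeriv f x (c • v) (c • w) := by
  rcases eq_or_ne c 0 with rfl | hc
  · simp [HasDirDeriv, tendsto_const_nhds]
  · have h1 : Tendsto (fun t : ℝ => t * c) (𝓝[≠] 0) (𝓝[≠] 0) := by
      refine tendsto_nhdsWithin_iff.2 ⟨?_, ?_⟩
      · have : Continuous fun t : ℝ => t * c := by fun_prop
        simpa using (this.tendsto 0).mono_left nhdsWithin_le_nhds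
      · filter_upwards [self_mem_nhdsWithin] with t ht
        exact mul_ne_zero ht hc
    refine ((h.comp h1).const_smul c).congr' ?_
    filter_upwards [self_mem_nhdsWithin] with t ht
    simp only [Function.comp, smul_smul, mul_inv]
    congr 1
    field_simp

theorem HasDirDeriv.hasDerivAt {c : ℝ → F} {s : ℝ} {w : F} (h : HasDirDeriv c s 1 w)
    (L : F →L[ℝ] ℝ) : HasDerivAt (fun t => L (c t)) (L w) s := by
  rw [hasDerivAt_iff_tendsto_slope_zero]
  refine ((L.continuous.tendsto w).comp h).congr fun t => ?_
  simp

section MeanValue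

variable [IsTopologicalAddGroup F] [ContinuousSMul ℝ F] [LocallyConvexSpace ℝ F]

/-- Cauchy's mean value theorem for curves in a locally convex space. -/
theorem slope_mem_of_deriv_mem {W : Set F} (hW : Convex ℝ W) (hW' : IsClosed W)
    {c c' w : ℝ → F} {g g' : ℝ → ℝ} {a b : ℝ} (hab : a < b)
    (hc : ∀ s ∈ Icc a b, HasDirDeriv c s 1 (c' s)) (hcw : ∀ s ∈ Ioo a b, c' s = g' s • w s)
    (hg : ∀ s ∈ Icc a b, HasDerivAt g (g' s) s) (hg' : ∀ s ∈ Ioo a b, g' s ≠ 0)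
    (hgab : g a ≠ g b) (hw : ∀ s ∈ Ioo a b, w s ∈ W) :
    (g b - g a)⁻¹ • (c b - c a) ∈ W := by
  -- If the slope lay outside W, a functional L would separate it strictly from W. The scalar Cauchy
  -- theorem for L ∘ c and g makes L of the slope equal to L (w s) at some interior s, where w s ∈
  -- W.
  by_contra hx
  obtain ⟨L, r, h1, h2⟩ := geometric_hahn_banach_closed_point hW hW' hx
  obtain ⟨s, hs, hs'⟩ := exists_ratio_hasDerivAt_eq_ratio_slope (fun t => L (c t))
    (fun t => L (c' t)) hab
    (fun t ht => ((hc t ht).hasDerivAt L).continuousAt.continuousWithinAt)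
    (fun t ht => (hc t (Ioo_subset_Icc_self ht)).hasDerivAt L) g g'
    (fun t ht => (hg t ht).continuousAt.continuousWithinAt)
    (fun t ht => hg t (Ioo_subset_Icc_self ht))
  have h3 := h1 _ (hw s hs)
  have h4 : g b - g a ≠ 0 := sub_ne_zero.2 hgab.symm
  have h5 : L ((g b - g a)⁻¹ • (c b - c a)) = L (w s) := by
    have h6 := hg' s hs
    simp only [hcw s hs, map_smul, map_sub, smul_eq_mul] at hs' ⊢
    field_simp
    apply mul_right_cancel₀ h6
    linarith
  linarith

/-- Supplies the sets to which the mean value theorem applies: by local convexity and regularity,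
convergence need only be tested on closed convex neighbourhoods. -/
theorem exists_closed_convex_nhds {x : F} {U : Set F} (hU : U ∈ 𝓝 x) :
    ∃ W ∈ 𝓝 x, IsClosed W ∧ Convex ℝ W ∧ W ⊆ U := by
  obtain ⟨V, hV, hVc, hVU⟩ := exists_mem_nhds_isClosed_subset hU
  obtain ⟨W, ⟨hW, hWc⟩, hWV⟩ := (LocallyConvexSpace.convex_basis (𝕜 := ℝ) x).mem_iff.1 hV
  exact ⟨closure W, mem_of_superset hW subset_closure, isClosed_closure, hWc.closure,
    (closure_minimal hWV hVc).trans hVU⟩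

/-- Continuously differentiable maps are strictly differentiable, in the sense that their
difference quotients converge when base point, direction and step converge simultaneously. -/
theorem tendsto_diffQuot {f : E → F} {df : E × E → F} {U : Set E} (hU : IsOpen U)
    (hf : ∀ x ∈ U, ∀ v, HasDirDeriv f x v (df (x, v)))
    (hdf : ContinuousOn df (U ×ˢ univ)) {ι : Type*} {l : Filter ι} {x v : ι → E} {s : ι → ℝ}
    {x₀ v₀ : E} (hx₀ : x₀ ∈ U) (hx : Tendsto x l (𝓝 x₀)) (hv : Tendsto v l (𝓝 v₀))
    (hs : Tendsto s l (𝓝[≠] 0)) :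
    Tendsto (fun i => (s i)⁻¹ • (f (x i + s i • v i) - f (x i))) l (𝓝 (df (x₀, v₀))) := by
  refine fun T hT => mem_map.2 ?_
  obtain ⟨W, hW, hWcl, hWcv, hWT⟩ := exists_closed_convex_nhds hT
  -- Compactness of [0, 1] makes the control of `df` uniform along the whole segment from x to x + s
  -- v; the mean value theorem in σ then applies.
  have key : ∀ᶠ q : E × E × ℝ in 𝓝 (x₀, v₀, 0), ∀ σ ∈ Icc (0 : ℝ) 1,
      q.1 + (σ * q.2.2) • q.2.1 ∈ U ∧ df (q.1 + (σ * q.2.2) • q.2.1, q.2.1) ∈ W := by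
    refine isCompact_Icc.eventually_forall_of_forall_eventually fun σ _ => ?_
    have c1 : Continuous fun z : (E × E × ℝ) × ℝ =>
        (z.1.1 + (z.2 * z.1.2.2) • z.1.2.1, z.1.2.1) := by fun_prop
    have c2 := c1.tendsto ((x₀, v₀, 0), σ)
    simp only [mul_zero, zero_smul, add_zero] at c2
    have hO : IsOpen (U ×ˢ (univ : Set E)) := hU.prod isOpen_univ
    have hm : (x₀, v₀) ∈ U ×ˢ (univ : Set E) := ⟨hx₀, trivial⟩
    filter_upwards [c2.eventually (hO.mem_nhds hm),
      c2.eventually ((hdf.continuousAt (hO.mem_nhds hm)).eventually hW)] with z h1 h2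
    exact ⟨h1.1, h2⟩
  have hs' := tendsto_nhdsWithin_iff.1 hs
  have ht : Tendsto (fun i => (x i, v i, s i)) l (𝓝 (x₀, v₀, 0)) :=
    hx.prodMk_nhds (hv.prodMk_nhds hs'.1)
  filter_upwards [ht.eventually key, hs'.2] with i hi hsi
  apply hWT
  have hsi : s i ≠ 0 := hsi
  have := slope_mem_of_deriv_mem hWcv hWcl (c := fun σ => f (x i + (σ * s i) • v i))
    (w := fun σ => df (x i + (σ * s i) • v i, v i)) (g := fun σ => σ * s i) (g' := fun _ => s i)
    (c' := fun σ => s i • df (x i + (σ * s i) • v i, v i))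
    zero_lt_one ?_ (fun _ _ => rfl) ?_ (fun _ _ => hsi) (by simpa using hsi.symm)
    fun σ hσ => (hi σ (Ioo_subset_Icc_self hσ)).2
  · simpa using this
  · intro σ hσ
    refine Tendsto.congr (fun t => ?_) ((hf _ (hi σ hσ).1 (v i)).smul_dir (s i))
    simp only [smul_smul, add_assoc, ← add_smul, smul_eq_mul, mul_one, add_mul]
  · intro σ _
    simpa using (hasDerivAt_id σ).mul_const (s i)

end MeanValue

/-! ### Maps of class `C^n` -/

theorem CnOn.continuousOn {n : ℕ} {f : E → F} {U : Set E} (h : CnOn n f U) :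
    ContinuousOn f U := by
  cases n with
  | zero => exact h
  | succ n => exact h.1

theorem CnOn.congr (n : ℕ) : ∀ {E : Type u} [AddCommGroup E] [Module ℝ E] [TopologicalSpace E]
    [IsTopologicalAddGroup E] [ContinuousSMul ℝ E]
    {F : Type v} [AddCommGroup F] [Module ℝ F] [TopologicalSpace F] {f g : E → F} {U : Set E},
    CnOn n f U → IsOpen U → EqOn f g U → CnOn n g U := by
  cases n with
  | zero => intro E _ _ _ _ _ F _ _ _ f g U h _ hfg; exact ContinuousOn.congr h hfg.symm
  | succ n =>
    rintro E _ _ _ _ _ F _ _ _ f g U ⟨h1, df, h2, h3⟩ hU hfg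
    exact ⟨h1.congr hfg.symm, df,
      fun x hx v => (h2 x hx v).congr (mem_of_superset (hU.mem_nhds hx) hfg), h3⟩

theorem CnOn.mono (n : ℕ) : ∀ {E : Type u} [AddCommGroup E] [Module ℝ E] [TopologicalSpace E]
    {F : Type v} [AddCommGroup F] [Module ℝ F] [TopologicalSpace F] {f : E → F} {U V : Set E},
    CnOn n f U → V ⊆ U → CnOn n f V := by
  induction n with
  | zero => intro E _ _ _ F _ _ _ f U V h hV; exact ContinuousOn.mono h hV
  | succ n ih =>
    rintro E _ _ _ F _ _ _ f U V ⟨h1, df, h2, h3⟩ hV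
    exact ⟨h1.mono hV, df, fun x hx => h2 x (hV hx), ih h3 (prod_mono hV subset_rfl)⟩

theorem CnOn.of_succ (n : ℕ) : ∀ {E : Type u} [AddCommGroup E] [Module ℝ E] [TopologicalSpace E]
    {F : Type v} [AddCommGroup F] [Module ℝ F] [TopologicalSpace F] {f : E → F} {U : Set E},
    CnOn (n + 1) f U → CnOn n f U := by
  induction n with
  | zero => rintro E _ _ _ F _ _ _ f U ⟨h1, -⟩; exact h1
  | succ n ih =>
    rintro E _ _ _ F _ _ _ f U ⟨h1, df, h2, h3⟩
    exact ⟨h1, df, h2, ih h3⟩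

/-- In a Hausdorff target the derivative is forced, so the existential `df` can be replaced by the
canonical `dirDeriv`. This is what lets local derivatives glue in `CnOn.of_local`. -/
theorem cnOn_succ_iff {n : ℕ} [T2Space F] {f : E → F} {U : Set E} (hU : IsOpen U) :
    CnOn (n + 1) f U ↔ ContinuousOn f U ∧ (∀ x ∈ U, ∀ v, HasDirDeriv f x v (dirDeriv f x v)) ∧
      CnOn n (fun p : E × E => dirDeriv f p.1 p.2) (U ×ˢ univ) := by
  constructor
  · rintro ⟨h1, df, h2, h3⟩
    refine ⟨h1, fun x hx v => ?_, CnOn.congr n h3 (hU.prod isOpen_univ) fun p hp => ?_⟩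
    · rw [(h2 x hx v).dirDeriv_eq]; exact h2 x hx v
    · exact ((h2 p.1 hp.1 p.2).dirDeriv_eq).symm
  · rintro ⟨h1, h2, h3⟩
    exact ⟨h1, _, h2, h3⟩

theorem CnOn.of_local (n : ℕ) : ∀ {E : Type u} [AddCommGroup E] [Module ℝ E] [TopologicalSpace E]
    [IsTopologicalAddGroup E] [ContinuousSMul ℝ E]
    {F : Type v} [AddCommGroup F] [Module ℝ F] [TopologicalSpace F] [T2Space F]
    {f : E → F} {U : Set E}, IsOpen U →
    (∀ x ∈ U, ∃ V : Set E, IsOpen V ∧ x ∈ V ∧ CnOn n f V) → CnOn n f U := by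
  induction n with
  | zero =>
    intro E _ _ _ _ _ F _ _ _ _ f U hU h x hx
    obtain ⟨V, hV, hxV, hf⟩ := h x hx
    exact (ContinuousOn.continuousAt hf (hV.mem_nhds hxV)).continuousWithinAt
  | succ n ih =>
    intro E _ _ _ _ _ F _ _ _ _ f U hU h
    refine (cnOn_succ_iff hU).2 ⟨fun x hx => ?_, fun x hx => ?_,
      ih (hU.prod isOpen_univ) fun p hp => ?_⟩
    · obtain ⟨V, hV, hxV, hf⟩ := h x hx
      exact (hf.1.continuousAt (hV.mem_nhds hxV)).continuousWithinAt
    · obtain ⟨V, hV, hxV, hf⟩ := h x hx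
      exact ((cnOn_succ_iff hV).1 hf).2.1 x hxV
    · obtain ⟨V, hV, hxV, hf⟩ := h p.1 hp.1
      exact ⟨V ×ˢ univ, hV.prod isOpen_univ, ⟨hxV, trivial⟩, ((cnOn_succ_iff hV).1 hf).2.2⟩

theorem cnOn_const (n : ℕ) : ∀ {E : Type u} [AddCommGroup E] [Module ℝ E] [TopologicalSpace E]
    {F : Type v} [AddCommGroup F] [Module ℝ F] [TopologicalSpace F] (c : F) (U : Set E),
    CnOn n (fun _ : E => c) U := by
  induction n with
  | zero => intro E _ _ _ F _ _ _ c U; exact continuousOn_const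
  | succ n ih =>
    intro E _ _ _ F _ _ _ c U
    refine ⟨continuousOn_const, fun _ => 0, fun x _ v => ?_, ih _ _⟩
    simp [HasDirDeriv, tendsto_const_nhds]

theorem cnOn_clm (n : ℕ) : ∀ {E : Type u} [AddCommGroup E] [Module ℝ E] [TopologicalSpace E]
    {F : Type v} [AddCommGroup F] [Module ℝ F] [TopologicalSpace F] (L : E →L[ℝ] F) (U : Set E),
    CnOn n (fun x => L x) U := by
  induction n with
  | zero => intro E _ _ _ F _ _ _ L U; exact L.continuous.continuousOn
  | succ n ih =>
    intro E _ _ _ F _ _ _ L U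
    refine ⟨L.continuous.continuousOn, fun p => (L.comp (ContinuousLinearMap.snd ℝ E E)) p,
      fun x _ v => ?_, ih _ _⟩
    refine tendsto_const_nhds.congr' ?_
    filter_upwards [self_mem_nhdsWithin] with t ht
    have ht : t ≠ 0 := ht
    simp [smul_smul, ht]

theorem CnOn.prodMk (n : ℕ) : ∀ {E : Type u} [AddCommGroup E] [Module ℝ E] [TopologicalSpace E]
    {F : Type v} [AddCommGroup F] [Module ℝ F] [TopologicalSpace F]
    {F' : Type w} [AddCommGroup F'] [Module ℝ F'] [TopologicalSpace F']
    {f : E → F} {g : E → F'} {U : Set E}, CnOn n f U → CnOn n g U →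
    CnOn n (fun x => (f x, g x)) U := by
  induction n with
  | zero => intro E _ _ _ F _ _ _ F' _ _ _ f g U hf hg; exact ContinuousOn.prodMk hf hg
  | succ n ih =>
    rintro E _ _ _ F _ _ _ F' _ _ _ f g U ⟨hf, df, hf1, hf2⟩ ⟨hg, dg, hg1, hg2⟩
    exact ⟨hf.prodMk hg, fun p => (df p, dg p),
      fun x hx v => (hf1 x hx v).prodMk_nhds (hg1 x hx v), ih hf2 hg2⟩

/-- For a linear inner map the chain rule is immediate. This case comes before the general one
because the latter needs f ∘ fst to be of class `CnOn`. -/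
theorem CnOn.comp_clm (n : ℕ) : ∀ {E : Type u} [AddCommGroup E] [Module ℝ E] [TopologicalSpace E]
    {F : Type v} [AddCommGroup F] [Module ℝ F] [TopologicalSpace F]
    {F' : Type w} [AddCommGroup F'] [Module ℝ F'] [TopologicalSpace F']
    {f : F → F'} {V : Set F} {U : Set E}, CnOn n f V → ∀ L : E →L[ℝ] F, MapsTo L U V →
    CnOn n (fun x => f (L x)) U := by
  induction n with
  | zero =>
    intro E _ _ _ F _ _ _ F' _ _ _ f V U hf L h
    exact ContinuousOn.comp hf L.continuous.continuousOn h
  | succ n ih =>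
    rintro E _ _ _ F _ _ _ F' _ _ _ f V U ⟨hf, df, hf1, hf2⟩ L h
    refine ⟨hf.comp L.continuous.continuousOn h, fun p => df (L.prodMap L p), fun x hx v => ?_,
      ih hf2 (L.prodMap L) fun p hp => ⟨h hp.1, trivial⟩⟩
    exact Tendsto.congr (fun t => by simp) (hf1 (L x) (h hx) (L v))

theorem HasDirDeriv.comp {E : Type u} [AddCommGroup E] [Module ℝ E] [TopologicalSpace E]
    [IsTopologicalAddGroup E] [ContinuousSMul ℝ E]
    {F : Type v} [AddCommGroup F] [Module ℝ F] [TopologicalSpace F]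
    [IsTopologicalAddGroup F] [ContinuousSMul ℝ F]
    {F' : Type w} [AddCommGroup F'] [Module ℝ F'] [TopologicalSpace F']
    [IsTopologicalAddGroup F'] [ContinuousSMul ℝ F'] [LocallyConvexSpace ℝ F']
    {f : F → F'} {g : E → F} {df : F × F → F'} {V : Set F} {x v : E} {w : F} (hV : IsOpen V)
    (hf : ∀ x ∈ V, ∀ v, HasDirDeriv f x v (df (x, v))) (hdf : ContinuousOn df (V ×ˢ univ))
    (hg : HasDirDeriv g x v w) (hx : g x ∈ V) :
    HasDirDeriv (fun x => f (g x)) x v (df (g x, w)) := by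
  refine (tendsto_diffQuot hV hf hdf hx tendsto_const_nhds hg tendsto_id).congr' ?_
  filter_upwards [self_mem_nhdsWithin] with t ht
  have ht : t ≠ 0 := ht
  simp [smul_smul, ht]

/-- The derivative (x, v) ↦ df (g x, dg (x, v)) is again a composition, of `df` with a pair of maps
of class one lower, so the induction runs over all spaces at once. -/
theorem CnOn.comp (n : ℕ) : ∀ {E : Type u} [AddCommGroup E] [Module ℝ E] [TopologicalSpace E]
    [IsTopologicalAddGroup E] [ContinuousSMul ℝ E]
    {F : Type v} [AddCommGroup F] [Module ℝ F] [TopologicalSpace F]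
    [IsTopologicalAddGroup F] [ContinuousSMul ℝ F]
    {F' : Type w} [AddCommGroup F'] [Module ℝ F'] [TopologicalSpace F']
    [IsTopologicalAddGroup F'] [ContinuousSMul ℝ F'] [LocallyConvexSpace ℝ F']
    {f : F → F'} {g : E → F} {V : Set F} {U : Set E}, CnOn n f V → CnOn n g U → IsOpen V →
    MapsTo g U V → IsOpen U →
    CnOn n (fun x => f (g x)) U := by
  induction n with
  | zero =>
    intro E _ _ _ _ _ F _ _ _ _ _ F' _ _ _ _ _ _ f g V U hf hg _ h _
    exact ContinuousOn.comp hf hg h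
  | succ n ih =>
    intro E _ _ _ _ _ F _ _ _ _ _ F' _ _ _ _ _ _ f g V U hf hg hV h hU
    have hg' := CnOn.of_succ n hg
    obtain ⟨hf0, df, hf1, hf2⟩ := hf
    obtain ⟨hg0, dg, hg1, hg2⟩ := hg
    refine ⟨hf0.comp hg0 h, fun p => df (g p.1, dg p),
      fun x hx v => (hg1 x hx v).comp hV hf1 hf2.continuousOn (h hx),
      ih hf2 (CnOn.prodMk n (CnOn.comp_clm n hg' (ContinuousLinearMap.fst ℝ E E) ?_) hg2)
        (hV.prod isOpen_univ) ?_ (hU.prod isOpen_univ)⟩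
    · exact fun p hp => hp.1
    · exact fun p hp => ⟨h hp.1, trivial⟩

/-- The derivative is the sum of two copies of the same map precomposed with linear maps, so the
class of the map bootstraps. -/
theorem cnOn_smul (n : ℕ) : ∀ {E : Type u} [AddCommGroup E] [Module ℝ E] [TopologicalSpace E]
    [IsTopologicalAddGroup E] [ContinuousSMul ℝ E] [LocallyConvexSpace ℝ E],
    CnOn n (fun p : ℝ × E => p.1 • p.2) univ := by
  intro E _ _ _ _ _ _
  induction n with
  | zero => exact continuous_smul.continuousOn
  | succ n ih =>
    refine ⟨continuous_smul.continuousOn,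
      fun q => q.2.1 • q.1.2 + q.1.1 • q.2.2, fun x _ v => ?_, ?_⟩
    · have h : Tendsto (fun t : ℝ => v.1 • x.2 + x.1 • v.2 + t • v.1 • v.2) (𝓝[≠] 0)
          (𝓝 (v.1 • x.2 + x.1 • v.2)) := tendsto_add_smul _ _
      refine h.congr' ?_
      filter_upwards [self_mem_nhdsWithin] with t ht
      have ht : t ≠ 0 := ht
      simp only [Prod.fst_add, Prod.snd_add, Prod.smul_fst, Prod.smul_snd]
      have : (x.1 + t • v.1) • (x.2 + t • v.2) - x.1 • x.2
          = t • (v.1 • x.2 + x.1 • v.2 + t • v.1 • v.2) := by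
        simp only [smul_eq_mul]
        module
      rw [this, inv_smul_smul₀ ht]
    · let A : E × E →L[ℝ] E := ContinuousLinearMap.fst ℝ E E + ContinuousLinearMap.snd ℝ E E
      let L1 : (ℝ × E) × (ℝ × E) →L[ℝ] ℝ × E :=
        ((ContinuousLinearMap.fst ℝ ℝ E).comp (ContinuousLinearMap.snd ℝ _ _)).prod
          ((ContinuousLinearMap.snd ℝ ℝ E).comp (ContinuousLinearMap.fst ℝ _ _))
      let L2 : (ℝ × E) × (ℝ × E) →L[ℝ] ℝ × E :=
        ((ContinuousLinearMap.fst ℝ ℝ E).comp (ContinuousLinearMap.fst ℝ _ _)).prod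
          ((ContinuousLinearMap.snd ℝ ℝ E).comp (ContinuousLinearMap.snd ℝ _ _))
      exact CnOn.comp n (cnOn_clm n A univ) (CnOn.prodMk n
        (CnOn.comp_clm n ih L1 fun _ _ => trivial) (CnOn.comp_clm n ih L2 fun _ _ => trivial))
        isOpen_univ (fun _ _ => trivial) (isOpen_univ.prod isOpen_univ)

theorem cnOn_of_contDiff (n : ℕ) : ∀ {f : ℝ → ℝ}, ContDiff ℝ n f → CnOn n f univ := by
  induction n with
  | zero => intro f hf; exact hf.continuous.continuousOn
  | succ n ih =>
    intro f hf
    have hf' : ContDiff ℝ n (deriv f) := ((contDiff_succ_iff_deriv).1 (by exact_mod_cast hf)).2.2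
    refine ⟨hf.continuous.continuousOn, fun p => p.2 • deriv f p.1, fun x _ v => ?_, ?_⟩
    · have h1 : HasDerivAt f (deriv f x) x :=
        (hf.differentiable (by simp) x).hasDerivAt
      have h2 : HasDirDeriv f x 1 (deriv f x) := by
        refine (hasDerivAt_iff_tendsto_slope_zero.1 h1).congr fun t => by simp
      simpa using h2.smul_dir v
    · refine CnOn.comp n (cnOn_smul n (E := ℝ)) (CnOn.prodMk n
        (cnOn_clm n (ContinuousLinearMap.snd ℝ ℝ ℝ) _)
        (CnOn.comp_clm n (ih hf') (ContinuousLinearMap.fst ℝ ℝ ℝ) fun _ _ => trivial))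
        isOpen_univ (fun _ _ => trivial) (isOpen_univ.prod isOpen_univ)

/-! ### Smooth maps -/

section SmoothOn

variable {F : Type v} [AddCommGroup F] [Module ℝ F] [TopologicalSpace F]
  [IsTopologicalAddGroup F] [ContinuousSMul ℝ F]
  {F' : Type w} [AddCommGroup F'] [Module ℝ F'] [TopologicalSpace F']
  [IsTopologicalAddGroup F'] [ContinuousSMul ℝ F']

theorem SmoothOn.comp [LocallyConvexSpace ℝ F'] {f : F → F'} {g : E → F} {V : Set F} {U : Set E}
    (hf : SmoothOn f V) (hg : SmoothOn g U) (hV : IsOpen V) (h : MapsTo g U V) (hU : IsOpen U) :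
    SmoothOn (fun x => f (g x)) U :=
  fun n => CnOn.comp n (hf n) (hg n) hV h hU

theorem SmoothOn.prodMk {f : E → F} {g : E → F'} {U : Set E} (hf : SmoothOn f U)
    (hg : SmoothOn g U) : SmoothOn (fun x => (f x, g x)) U :=
  fun n => CnOn.prodMk n (hf n) (hg n)

theorem SmoothOn.congr {f g : E → F} {U : Set E} (hf : SmoothOn f U) (hU : IsOpen U)
    (hfg : EqOn f g U) : SmoothOn g U :=
  fun n => CnOn.congr n (hf n) hU hfg

theorem SmoothOn.mono {f : E → F} {U V : Set E} (hf : SmoothOn f U) (hV : V ⊆ U) :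
    SmoothOn f V :=
  fun n => CnOn.mono n (hf n) hV

theorem SmoothOn.of_local [T2Space F] {f : E → F} {U : Set E} (hU : IsOpen U)
    (h : ∀ x ∈ U, ∃ V : Set E, IsOpen V ∧ x ∈ V ∧ SmoothOn f V) : SmoothOn f U :=
  fun n => CnOn.of_local n hU fun x hx =>
    let ⟨V, h1, h2, h3⟩ := h x hx
    ⟨V, h1, h2, h3 n⟩

theorem smoothOn_const (c : F) (U : Set E) : SmoothOn (fun _ : E => c) U :=
  fun n => cnOn_const n c U

theorem smoothOn_clm (L : E →L[ℝ] F) (U : Set E) : SmoothOn (fun x => L x) U :=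
  fun n => cnOn_clm n L U

theorem smoothOn_id (U : Set E) : SmoothOn (fun x => x) U :=
  smoothOn_clm (ContinuousLinearMap.id ℝ E) U

theorem smoothOn_of_contDiff {f : ℝ → ℝ} (hf : ∀ n : ℕ, ContDiff ℝ n f) : SmoothOn f univ :=
  fun n => cnOn_of_contDiff n (hf n)

theorem SmoothOn.add [LocallyConvexSpace ℝ F] {f g : E → F} {U : Set E} (hf : SmoothOn f U)
    (hg : SmoothOn g U) (hU : IsOpen U) : SmoothOn (fun x => f x + g x) U :=
  (smoothOn_clm (ContinuousLinearMap.fst ℝ F F + ContinuousLinearMap.snd ℝ F F) univ).comp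
    (hf.prodMk hg) isOpen_univ (fun _ _ => trivial) hU

theorem SmoothOn.smul [LocallyConvexSpace ℝ F] {f : E → ℝ} {g : E → F} {U : Set E}
    (hf : SmoothOn f U) (hg : SmoothOn g U) (hU : IsOpen U) : SmoothOn (fun x => f x • g x) U :=
  SmoothOn.comp (f := fun p : ℝ × F => p.1 • p.2) (fun n => cnOn_smul n)
    (hf.prodMk hg) isOpen_univ (fun _ _ => trivial) hU

theorem SmoothOn.continuousOn {f : E → F} {U : Set E} (hf : SmoothOn f U) : ContinuousOn f U :=
  hf 0

section T2

variable [T2Space F]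

theorem SmoothOn.hasDirDeriv {f : E → F} {U : Set E} (hf : SmoothOn f U) (hU : IsOpen U) {x : E}
    (hx : x ∈ U) (v : E) : HasDirDeriv f x v (dirDeriv f x v) :=
  ((cnOn_succ_iff hU).1 (hf 1)).2.1 x hx v

theorem SmoothOn.tangent {f : E → F} {U : Set E} (hf : SmoothOn f U) (hU : IsOpen U) :
    SmoothOn (fun p : E × E => dirDeriv f p.1 p.2) (U ×ˢ univ) :=
  fun n => ((cnOn_succ_iff hU).1 (hf (n + 1))).2.2

variable [LocallyConvexSpace ℝ F]

theorem SmoothOn.dirDeriv {f : E → F} {U : Set E} (hf : SmoothOn f U) (hU : IsOpen U) (v : E) :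
    SmoothOn (fun x => LCLie.dirDeriv f x v) U :=
  SmoothOn.comp (f := fun p : E × E => LCLie.dirDeriv f p.1 p.2) (g := fun x => (x, v))
    (hf.tangent hU) ((smoothOn_id U).prodMk (smoothOn_const v U)) (hU.prod isOpen_univ)
    (fun _ hx => ⟨hx, trivial⟩) hU

theorem SmoothOn.tendsto {f : E → F} {U : Set E} (hf : SmoothOn f U) (hU : IsOpen U)
    {ι : Type*} {l : Filter ι} {x v : ι → E} {s : ι → ℝ}
    {x₀ v₀ : E} (hx₀ : x₀ ∈ U) (hx : Tendsto x l (𝓝 x₀)) (hv : Tendsto v l (𝓝 v₀))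
    (hs : Tendsto s l (𝓝[≠] 0)) :
    Tendsto (fun i => (s i)⁻¹ • (f (x i + s i • v i) - f (x i))) l
      (𝓝 (LCLie.dirDeriv f x₀ v₀)) :=
  tendsto_diffQuot (df := fun p => LCLie.dirDeriv f p.1 p.2) hU
    (fun _ hx v => hf.hasDirDeriv hU hx v) (hf.tangent hU).continuousOn hx₀ hx hv hs

theorem SmoothOn.dirDeriv_zero {f : E → F} {x : E} : LCLie.dirDeriv f x 0 = 0 :=
  HasDirDeriv.dirDeriv_eq (by simp [HasDirDeriv])

end T2

end SmoothOn

end Calculus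

/-! ### Taylor's formula at 0 for smooth curves, and its converse. -/

section Taylor

universe v

variable {F : Type v} [AddCommGroup F] [Module ℝ F] [TopologicalSpace F]

theorem eqOn_curveDeriv {c d : ℝ → F} {O : Set ℝ} (hO : IsOpen O) (h : EqOn c d O) :
    EqOn (curveDeriv c) (curveDeriv d) O :=
  fun _ ht => dirDeriv_congr (mem_of_superset (hO.mem_nhds ht) h) 1

variable [IsTopologicalAddGroup F] [ContinuousSMul ℝ F] [LocallyConvexSpace ℝ F] [T2Space F]

theorem SmoothOn.curveDeriv {c : ℝ → F} {O : Set ℝ} (hc : SmoothOn c O) (hO : IsOpen O) :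
    SmoothOn (curveDeriv c) O :=
  hc.dirDeriv hO 1

-- A vector-valued l'Hôpital rule: Cauchy's mean value theorem with g(s) = s^(k+1)/(k+1). The sign
-- of t decides which of 0 and t is the left endpoint.
omit [T2Space F] in
theorem tendsto_inv_pow_smul_sub {c c' : ℝ → F} {r : ℝ} (hr : 0 < r)
    (hc : ∀ s ∈ Ioo (-r) r, HasDirDeriv c s 1 (c' s)) {k : ℕ} {L : F}
    (h : Tendsto (fun s => (s ^ k)⁻¹ • c' s) (𝓝[≠] 0) (𝓝 L)) :
    Tendsto (fun t => (t ^ (k + 1))⁻¹ • (c t - c 0)) (𝓝[≠] 0) (𝓝 ((k + 1 : ℝ)⁻¹ • L)) := by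
  have hk : (k + 1 : ℝ) ≠ 0 := by positivity
  have key : Tendsto (fun t : ℝ => (t ^ (k + 1) / (k + 1))⁻¹ • (c t - c 0)) (𝓝[≠] 0) (𝓝 L) := by
    refine fun T hT => mem_map.2 ?_
    obtain ⟨W, hW, hWcl, hWcv, hWT⟩ := exists_closed_convex_nhds hT
    obtain ⟨δ, hδ, hδW⟩ := Metric.mem_nhdsWithin_iff.1 (h hW)
    have hmem : Metric.ball (0 : ℝ) (min δ r) ∈ 𝓝[≠] (0 : ℝ) :=
      mem_nhdsWithin_of_mem_nhds (Metric.ball_mem_nhds _ (lt_min hδ hr))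
    filter_upwards [hmem, self_mem_nhdsWithin] with t ht ht0
    have ht0 : t ≠ 0 := ht0
    apply hWT
    rw [mem_ball_zero_iff, Real.norm_eq_abs, lt_min_iff] at ht
    obtain ⟨ht1, ht2⟩ := ht
    have hs : ∀ s, |s| ≤ |t| → s ≠ 0 → (s ^ k)⁻¹ • c' s ∈ W := fun s hs hs0 =>
      hδW ⟨by rw [mem_ball_zero_iff, Real.norm_eq_abs]; linarith, hs0⟩
    have hs' : ∀ s, |s| ≤ |t| → HasDirDeriv c s 1 (c' s) := fun s hs => by
      apply hc; rw [mem_Ioo, ← abs_lt]; linarith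
    have hg : ∀ s : ℝ, HasDerivAt (fun s : ℝ => s ^ (k + 1) / (k + 1)) (s ^ k) s := fun s => by
      have := (hasDerivAt_pow (k + 1) s).div_const (k + 1 : ℝ)
      simp only [Nat.add_sub_cancel] at this
      refine this.congr_deriv ?_
      push_cast
      exact mul_div_cancel_left₀ _ hk
    have hg0 : t ^ (k + 1) / (k + 1 : ℝ) ≠ 0 := div_ne_zero (pow_ne_zero _ ht0) hk
    have hcw : ∀ s : ℝ, s ≠ 0 → c' s = s ^ k • (s ^ k)⁻¹ • c' s := fun s hs => by
      rw [smul_inv_smul₀ (pow_ne_zero _ hs)]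
    rcases lt_or_gt_of_ne ht0 with hneg | hpos
    · have h0 : ∀ s ∈ Ioo t 0, s ≠ 0 := fun s hs => hs.2.ne
      have habs : ∀ s ∈ Icc t 0, |s| ≤ |t| := fun s hs => by
        rw [abs_of_nonpos hs.2, abs_of_neg hneg]; linarith [hs.1]
      have := slope_mem_of_deriv_mem hWcv hWcl hneg (fun s h => hs' s (habs s h))
        (fun s h => hcw s (h0 s h)) (fun s _ => hg s) (fun s h => pow_ne_zero _ (h0 s h))
        (by simpa using hg0) (fun s h => hs s (habs s (Ioo_subset_Icc_self h)) (h0 s h))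
      have hz : (0 : ℝ) ^ (k + 1) / (k + 1) = 0 := by simp
      rw [hz, zero_sub, inv_neg, neg_smul, ← smul_neg, neg_sub] at this
      exact this
    · have h0 : ∀ s ∈ Ioo 0 t, s ≠ 0 := fun s hs => hs.1.ne'
      have habs : ∀ s ∈ Icc 0 t, |s| ≤ |t| := fun s hs => by
        rw [abs_of_nonneg hs.1, abs_of_pos hpos]; exact hs.2
      have := slope_mem_of_deriv_mem hWcv hWcl hpos (fun s h => hs' s (habs s h))
        (fun s h => hcw s (h0 s h)) (fun s _ => hg s) (fun s h => pow_ne_zero _ (h0 s h))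
        (by simpa using hg0.symm) (fun s h => hs s (habs s (Ioo_subset_Icc_self h)) (h0 s h))
      simpa using this
  refine (key.const_smul (k + 1 : ℝ)⁻¹).congr fun t => ?_
  rw [smul_smul]
  congr 1
  rw [inv_div]
  field_simp

theorem tendsto_taylor {r : ℝ} (hr : 0 < r) {k : ℕ} (hk : 1 ≤ k) {c : ℝ → F}
    (hc : SmoothOn c (Ioo (-r) r)) (h : ∀ j, 1 ≤ j → j < k → curveDeriv^[j] c 0 = 0) :
    Tendsto (fun t => (t ^ k)⁻¹ • (c t - c 0)) (𝓝[≠] 0)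
      (𝓝 ((k.factorial : ℝ)⁻¹ • curveDeriv^[k] c 0)) := by
  induction k, hk using Nat.le_induction generalizing c with
  | base =>
    have := hc.hasDirDeriv isOpen_Ioo (show (0 : ℝ) ∈ Ioo (-r) r by simpa using hr) 1
    simpa [HasDirDeriv, LCLie.curveDeriv] using this
  | succ k hk ih =>
    have h1 := ih (hc.curveDeriv isOpen_Ioo) fun j hj hjk => h (j + 1) (by omega) (by omega)
    have h0 : curveDeriv c 0 = 0 := h 1 le_rfl (by omega)
    simp only [h0, sub_zero] at h1
    have := tendsto_inv_pow_smul_sub hr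
      (fun s hs => hc.hasDirDeriv isOpen_Ioo hs 1) (c' := curveDeriv c) h1
    rw [smul_smul, ← mul_inv] at this
    simpa [Nat.factorial_succ, Function.iterate_succ_apply] using this

/-- Strong induction on j: once the lower derivatives vanish, Taylor's formula of order j identifies
the j-th derivative by uniqueness of limits. -/
theorem iterate_curveDeriv_eq_of_tendsto {r : ℝ} (hr : 0 < r) {k : ℕ} {c : ℝ → F}
    (hc : SmoothOn c (Ioo (-r) r)) {X : F}
    (h : Tendsto (fun t => (t ^ k)⁻¹ • (c t - c 0)) (𝓝[≠] 0) (𝓝 X)) {j : ℕ} (hj : 1 ≤ j)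
    (hjk : j ≤ k) : curveDeriv^[j] c 0 = if j = k then (k.factorial : ℝ) • X else 0 := by
  induction j using Nat.strong_induction_on with
  | _ j ih =>
    have h1 := tendsto_taylor hr hj hc fun i hi hij => by
      rw [ih i hij hi (by omega), if_neg (by omega)]
    -- The factor 0 ^ (k - j) covers both cases: it is 1 for j = k and 0 for j < k.
    have h2 : Tendsto (fun t : ℝ => t ^ (k - j) • (t ^ k)⁻¹ • (c t - c 0)) (𝓝[≠] 0)
        (𝓝 ((0 : ℝ) ^ (k - j) • X)) := by
      refine Tendsto.smul ?_ h
      exact ((continuous_pow (k - j)).tendsto 0).mono_left nhdsWithin_le_nhds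
    have h3 : (0 : ℝ) ^ (k - j) • X = (j.factorial : ℝ)⁻¹ • curveDeriv^[j] c 0 := by
      refine tendsto_nhds_unique h2 (h1.congr' ?_)
      filter_upwards [self_mem_nhdsWithin] with t ht
      have ht : t ≠ 0 := ht
      rw [smul_smul]
      congr 1
      obtain ⟨i, rfl⟩ := Nat.exists_eq_add_of_le hjk
      rw [Nat.add_sub_cancel_left, pow_add]
      field_simp
    have h4 : (j.factorial : ℝ) ≠ 0 := by positivity
    rw [eq_inv_smul_iff₀ h4] at h3
    rw [← h3]
    split_ifs with hjk'
    · subst hjk'; simp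
    · rw [zero_pow (by omega)]; simp

end Taylor

/-! ### Mixed second differences of smooth maps. -/

section SecondDifference

universe u v

variable {E : Type u} [AddCommGroup E] [Module ℝ E] [TopologicalSpace E]
  [IsTopologicalAddGroup E] [ContinuousSMul ℝ E]

theorem hasDirDeriv_of_eventually_eq {F : Type v} [AddCommGroup F] [Module ℝ F]
    [TopologicalSpace F] {f : E → F} {x v : E} {w : F}
    (h : ∀ᶠ y in 𝓝 x, ∀ t : ℝ, y = x + t • v → f y = f x + t • w) : HasDirDeriv f x v w := by
  refine tendsto_const_nhds.congr' ?_
  filter_upwards [(tendsto_add_smul x v).eventually h, self_mem_nhdsWithin] with t ht ht0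
  have ht0 : t ≠ 0 := ht0
  rw [ht t rfl, add_sub_cancel_left, inv_smul_smul₀ ht0]

variable {E' : Type u} [AddCommGroup E'] [Module ℝ E'] [TopologicalSpace E']
  [IsTopologicalAddGroup E'] [ContinuousSMul ℝ E']
  {F : Type v} [AddCommGroup F] [Module ℝ F] [TopologicalSpace F]
  [IsTopologicalAddGroup F] [ContinuousSMul ℝ F] [LocallyConvexSpace ℝ F] [T2Space F]

/-- The mixed difference is the increment in the second variable of a first difference in the first
variable. The mean value theorem in the second variable reduces it to a difference quotient of the
tangent map, and strict differentiability gives the limit. -/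
theorem SmoothOn.tendsto_secondDiff {f : E × E' → F} {U : Set (E × E')} (hf : SmoothOn f U)
    (hU : IsOpen U) {ι : Type*} {l : Filter ι} {a A : ι → E} {b B : ι → E'} {s r : ι → ℝ}
    {a₀ A₀ : E} {b₀ B₀ : E'} (h₀ : (a₀, b₀) ∈ U)
    (ha : Tendsto a l (𝓝 a₀)) (hA : Tendsto A l (𝓝 A₀)) (hb : Tendsto b l (𝓝 b₀))
    (hB : Tendsto B l (𝓝 B₀)) (hs : Tendsto s l (𝓝[≠] 0)) (hr : Tendsto r l (𝓝[≠] 0)) :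
    Tendsto (fun i => (s i * r i)⁻¹ • (f (a i + s i • A i, b i + r i • B i) -
        f (a i, b i + r i • B i) - (f (a i + s i • A i, b i) - f (a i, b i)))) l
      (𝓝 (LCLie.dirDeriv (fun p : (E × E') × (E × E') => LCLie.dirDeriv f p.1 p.2)
        ((a₀, b₀), (0, B₀)) ((A₀, 0), (0, 0)))) := by
  have hs' := tendsto_nhdsWithin_iff.1 hs
  have hr' := tendsto_nhdsWithin_iff.1 hr
  refine fun T hT => mem_map.2 ?_
  obtain ⟨W, hW, hWcl, hWcv, hWT⟩ := exists_closed_convex_nhds hT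
  -- The product with a principal filter expresses uniformity in the position τ ∈ [0, 1] on the
  -- segment.
  let l' : Filter (ι × ℝ) := l ×ˢ 𝓟 (Icc 0 1)
  have hτ : Tendsto (fun q : ι × ℝ => q.2 * r q.1) l' (𝓝 0) := by
    have h1 : Tendsto (fun q : ι × ℝ => |r q.1|) l' (𝓝 0) := by
      simpa using (hr'.1.comp tendsto_fst).abs
    refine squeeze_zero_norm' ?_ h1
    refine eventually_prod_principal_iff.2 (Eventually.of_forall fun i τ hτ => ?_)
    rw [Real.norm_eq_abs, abs_mul, abs_of_nonneg hτ.1]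
    exact mul_le_of_le_one_left (abs_nonneg _) hτ.2
  have hbτ : Tendsto (fun q : ι × ℝ => b q.1 + (q.2 * r q.1) • B q.1) l' (𝓝 b₀) := by
    simpa using (hb.comp tendsto_fst).add (hτ.smul (hB.comp tendsto_fst))
  have has : Tendsto (fun i => a i + s i • A i) l (𝓝 a₀) := by
    simpa using ha.add (hs'.1.smul hA)
  have m1 := ((ha.comp tendsto_fst).prodMk_nhds hbτ).eventually (hU.mem_nhds h₀)
  have m2 := ((has.comp tendsto_fst).prodMk_nhds hbτ).eventually (hU.mem_nhds h₀)
  have lim := (hf.tangent hU).tendsto (hU.prod isOpen_univ) (l := l')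
    (x := fun q => ((a q.1, b q.1 + (q.2 * r q.1) • B q.1), ((0 : E), B q.1)))
    (v := fun q => ((A q.1, (0 : E')), ((0 : E), (0 : E')))) (s := fun q => s q.1)
    (x₀ := ((a₀, b₀), (0, B₀))) (v₀ := ((A₀, 0), (0, 0))) ⟨h₀, trivial⟩
    (((ha.comp tendsto_fst).prodMk_nhds hbτ).prodMk_nhds
      (tendsto_const_nhds.prodMk_nhds (hB.comp tendsto_fst)))
    (((hA.comp tendsto_fst).prodMk_nhds tendsto_const_nhds).prodMk_nhds tendsto_const_nhds)
    (hs.comp tendsto_fst)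
  filter_upwards [eventually_prod_principal_iff.1 m1, eventually_prod_principal_iff.1 m2,
    eventually_prod_principal_iff.1 (lim.eventually hW), hs'.2, hr'.2] with i i1 i2 i3 i4 i5
  have i4 : s i ≠ 0 := i4
  have i5 : r i ≠ 0 := i5
  apply hWT
  have hd : ∀ (a' : E) (τ : ℝ), (a', b i + (τ * r i) • B i) ∈ U →
      HasDirDeriv (fun τ : ℝ => f (a', b i + (τ * r i) • B i)) τ 1
        (r i • LCLie.dirDeriv f (a', b i + (τ * r i) • B i) (0, B i)) := fun a' τ h => by
    refine Tendsto.congr (fun t => ?_) ((hf.hasDirDeriv hU h (0, B i)).smul_dir (r i))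
    simp only [Prod.smul_mk, Prod.mk_add_mk, smul_zero, add_zero, smul_smul, smul_eq_mul, mul_one,
      add_mul, add_smul, add_assoc]
  have := slope_mem_of_deriv_mem hWcv hWcl zero_lt_one
    (c := fun τ => f (a i + s i • A i, b i + (τ * r i) • B i) - f (a i, b i + (τ * r i) • B i))
    (c' := fun τ => r i • LCLie.dirDeriv f (a i + s i • A i, b i + (τ * r i) • B i) (0, B i) -
      r i • LCLie.dirDeriv f (a i, b i + (τ * r i) • B i) (0, B i))
    (g := fun τ => τ * (s i * r i)) (g' := fun _ => s i * r i)
    (w := fun τ => (s i)⁻¹ • (LCLie.dirDeriv f (a i + s i • A i, b i + (τ * r i) • B i) (0, B i) -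
      LCLie.dirDeriv f (a i, b i + (τ * r i) • B i) (0, B i)))
    (fun τ h => ?_) (fun τ _ => ?_) (fun τ _ => ?_) (fun _ _ => mul_ne_zero i4 i5)
    (by simpa using ⟨i4, i5⟩) (fun τ h => ?_)
  · simpa using this
  · refine Tendsto.congr (fun t => ?_) ((hd (a i + s i • A i) τ (i2 τ h)).sub
      (hd (a i) τ (i1 τ h)))
    rw [← smul_sub]
    congr 1
    exact sub_sub_sub_comm _ _ _ _
  · rw [smul_smul, mul_comm (s i), mul_assoc, mul_inv_cancel₀ i4, mul_one, smul_sub]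
  · simpa using (hasDerivAt_id τ).mul_const (s i * r i)
  · have h3 := i3 τ (Ioo_subset_Icc_self h)
    simp only [Prod.smul_mk, Prod.mk_add_mk, smul_zero, add_zero] at h3
    exact h3

end SecondDifference

/-! ### The chart at the identity -/

section IdChart

variable (E : Type*) [AddCommGroup E] [Module ℝ E] [TopologicalSpace E]
  (G : Type*) [TopologicalSpace G] [ChartedSpace E G] [Group G]

/-- The preferred chart at the identity. -/
abbrev idChart : OpenPartialHomeomorph G E := chartAt E (1 : G)

/-- The coordinate of the identity. -/
abbrev idPt : E := idChart E G 1

/-- The multiplication, read in the chart at the identity. -/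
noncomputable def mulC (p : E × E) : E :=
  idChart E G ((idChart E G).symm p.1 * (idChart E G).symm p.2)

/-- The domain of `mulC`. -/
def mulDom : Set (E × E) :=
  ((idChart E G).target ×ˢ (idChart E G).target) ∩
    {p | (idChart E G).symm p.1 * (idChart E G).symm p.2 ∈ (idChart E G).source}

/-- The inversion, read in the chart at the identity. -/
noncomputable def invC (x : E) : E := idChart E G ((idChart E G).symm x)⁻¹

/-- The domain of `invC`. -/
def invDom : Set E :=
  (idChart E G).target ∩ {x | ((idChart E G).symm x)⁻¹ ∈ (idChart E G).source}

/-- The division `(g, h) ↦ g h⁻¹`, read in the chart at the identity. -/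
noncomputable def divC (p : E × E) : E := mulC E G (p.1, invC E G p.2)

/-- The domain of `divC`. -/
def divDom : Set (E × E) :=
  ((idChart E G).target ×ˢ invDom E G) ∩ (fun p => (p.1, invC E G p.2)) ⁻¹' mulDom E G

variable {E G}

theorem isTopologicalGroup (E : Type*) [AddCommGroup E] [Module ℝ E] [TopologicalSpace E]
    (G : Type*) [TopologicalSpace G] [ChartedSpace E G] [Group G] [h : LieGroup E G] :
    IsTopologicalGroup G :=
  h.toIsTopologicalGroup

theorem idPt_mem_target : idPt E G ∈ (idChart E G).target :=
  (idChart E G).map_source (mem_chart_source E 1)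

theorem symm_idPt : (idChart E G).symm (idPt E G) = 1 :=
  (idChart E G).left_inv (mem_chart_source E 1)

theorem source_mem_nhds_one : (idChart E G).source ∈ 𝓝 (1 : G) :=
  (idChart E G).open_source.mem_nhds (mem_chart_source E 1)

theorem tendsto_idChart {ι : Type*} {l : Filter ι} {g : ι → G} (hg : Tendsto g l (𝓝 1)) :
    Tendsto (fun i => idChart E G (g i)) l (𝓝 (idPt E G)) :=
  ((idChart E G).continuousAt (mem_chart_source E 1)).tendsto.comp hg

theorem tendsto_idChart_symm {ι : Type*} {l : Filter ι} {x : ι → E}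
    (hx : Tendsto x l (𝓝 (idPt E G))) : Tendsto (fun i => (idChart E G).symm (x i)) l (𝓝 1) := by
  have := ((idChart E G).symm.continuousAt (x := idPt E G) idPt_mem_target).tendsto
  rw [symm_idPt] at this
  exact this.comp hx

theorem mem_mulDom {g h : G} (hg : g ∈ (idChart E G).source) (hh : h ∈ (idChart E G).source)
    (hgh : g * h ∈ (idChart E G).source) : (idChart E G g, idChart E G h) ∈ mulDom E G := by
  refine ⟨⟨(idChart E G).map_source hg, (idChart E G).map_source hh⟩, ?_⟩
  simpa [(idChart E G).left_inv hg, (idChart E G).left_inv hh] using hgh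

theorem mulC_idChart {g h : G} (hg : g ∈ (idChart E G).source) (hh : h ∈ (idChart E G).source) :
    mulC E G (idChart E G g, idChart E G h) = idChart E G (g * h) := by
  simp [mulC, (idChart E G).left_inv hg, (idChart E G).left_inv hh]

theorem mem_invDom {g : G} (hg : g ∈ (idChart E G).source) (hg' : g⁻¹ ∈ (idChart E G).source) :
    idChart E G g ∈ invDom E G := by
  refine ⟨(idChart E G).map_source hg, ?_⟩
  simpa [(idChart E G).left_inv hg] using hg'

theorem invC_idChart {g : G} (hg : g ∈ (idChart E G).source) :
    invC E G (idChart E G g) = idChart E G g⁻¹ := by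
  simp [invC, (idChart E G).left_inv hg]

theorem mem_divDom {g h : G} (hg : g ∈ (idChart E G).source) (hh : h ∈ (idChart E G).source)
    (hh' : h⁻¹ ∈ (idChart E G).source) (hgh : g * h⁻¹ ∈ (idChart E G).source) :
    (idChart E G g, idChart E G h) ∈ divDom E G := by
  refine ⟨⟨(idChart E G).map_source hg, mem_invDom hh hh'⟩, ?_⟩
  simpa [invC_idChart hh] using mem_mulDom hg hh' hgh

theorem divC_idChart {g h : G} (hg : g ∈ (idChart E G).source) (hh : h ∈ (idChart E G).source)
    (hh' : h⁻¹ ∈ (idChart E G).source) :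
    divC E G (idChart E G g, idChart E G h) = idChart E G (g * h⁻¹) := by
  rw [divC, invC_idChart hh, mulC_idChart hg hh']

theorem idPt_mem_mulDom : (idPt E G, idPt E G) ∈ mulDom E G :=
  mem_mulDom (mem_chart_source E 1) (mem_chart_source E 1) (by simp)

theorem idPt_mem_divDom : (idPt E G, idPt E G) ∈ divDom E G :=
  mem_divDom (mem_chart_source E 1) (mem_chart_source E 1) (by simp) (by simp)

variable [IsTopologicalAddGroup E] [ContinuousSMul ℝ E] [LocallyConvexSpace ℝ E] [T2Space E]
  [LieGroup E G]

theorem isOpen_mulDom : IsOpen (mulDom E G) := by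
  have := isTopologicalGroup E G
  have hc : ContinuousOn (fun p : E × E => (idChart E G).symm p.1 * (idChart E G).symm p.2)
      ((idChart E G).target ×ˢ (idChart E G).target) :=
    ((idChart E G).symm.continuousOn.comp continuousOn_fst fun p hp => hp.1).mul
      ((idChart E G).symm.continuousOn.comp continuousOn_snd fun p hp => hp.2)
  exact hc.isOpen_inter_preimage ((idChart E G).open_target.prod (idChart E G).open_target)
    (idChart E G).open_source

theorem smoothOn_mulC : SmoothOn (mulC E G) (mulDom E G) :=
  LieGroup.smooth_mul _ (chart_mem_atlas E 1) _ (chart_mem_atlas E 1) _ (chart_mem_atlas E 1)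

theorem isOpen_invDom : IsOpen (invDom E G) := by
  have := isTopologicalGroup E G
  exact (idChart E G).symm.continuousOn.inv.isOpen_inter_preimage (idChart E G).open_target
    (idChart E G).open_source

theorem smoothOn_invC : SmoothOn (invC E G) (invDom E G) :=
  LieGroup.smooth_inv _ (chart_mem_atlas E 1) _ (chart_mem_atlas E 1)

theorem smoothOn_prod_invC :
    SmoothOn (fun p : E × E => (p.1, invC E G p.2)) ((idChart E G).target ×ˢ invDom E G) :=
  (smoothOn_clm (ContinuousLinearMap.fst ℝ E E) _).prodMk
    (smoothOn_invC.comp (smoothOn_clm (ContinuousLinearMap.snd ℝ E E) _) isOpen_invDom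
      (fun _ hp => hp.2) ((idChart E G).open_target.prod isOpen_invDom))

theorem isOpen_divDom : IsOpen (divDom E G) :=
  (smoothOn_prod_invC (E := E) (G := G)).continuousOn.isOpen_inter_preimage
    ((idChart E G).open_target.prod isOpen_invDom) isOpen_mulDom

theorem smoothOn_divC : SmoothOn (divC E G) (divDom E G) :=
  smoothOn_mulC.comp (smoothOn_prod_invC.mono inter_subset_left) isOpen_mulDom
    (fun _ hp => hp.2) isOpen_divDom

end IdChart

/-! ### Leading coefficients of families of group elements tending to the identity -/

section Lead

section TopologicalGroup

variable {G : Type*} [TopologicalSpace G] [Group G] [IsTopologicalGroup G] {ι : Type*}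
  {l : Filter ι} {g g' : ι → G}

theorem tendsto_mul_one (hg : Tendsto g l (𝓝 1)) (hg' : Tendsto g' l (𝓝 1)) :
    Tendsto (fun i => g i * g' i) l (𝓝 1) := by
  simpa using hg.mul hg'

theorem tendsto_inv_one (hg : Tendsto g l (𝓝 1)) : Tendsto (fun i => (g i)⁻¹) l (𝓝 1) := by
  simpa using hg.inv

end TopologicalGroup

variable {E : Type*} [AddCommGroup E] [Module ℝ E] [TopologicalSpace E]
  [IsTopologicalAddGroup E] [ContinuousSMul ℝ E] [LocallyConvexSpace ℝ E] [T2Space E]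
  {G : Type*} [TopologicalSpace G] [ChartedSpace E G] [Group G] [LieGroup E G]
  {ι : Type*} {l : Filter ι} {h h' : ι → ℝ} {g g' b : ι → G} {R S : E}

/-- Along the filter `l` the group elements `g i` tend to the identity, and in coordinates they are
`e + h i • (R + o(1))`. -/
structure Lead (l : Filter ι) (h : ι → ℝ) (g : ι → G) (R : E) : Prop where
  tendsto_one : Tendsto g l (𝓝 1)
  tendsto_quot : Tendsto (fun i => (h i)⁻¹ • (idChart E G (g i) - idPt E G)) l (𝓝 R)

theorem eventually_mem_source (hg : Tendsto g l (𝓝 1)) :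
    ∀ᶠ i in l, g i ∈ (idChart E G).source :=
  hg.eventually source_mem_nhds_one

theorem dirDeriv_mulC_right (R : E) :
    dirDeriv (mulC E G) (idPt E G, idPt E G) (0, R) = R := by
  apply HasDirDeriv.dirDeriv_eq
  apply hasDirDeriv_of_eventually_eq
  filter_upwards [(isOpen_mulDom (E := E) (G := G)).mem_nhds idPt_mem_mulDom] with y hy t ht
  have hy' := hy.1.2
  subst ht
  simp only [Prod.smul_mk, Prod.mk_add_mk, smul_zero, add_zero] at hy' ⊢
  simp only [mulC, symm_idPt, one_mul, (idChart E G).right_inv hy']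

theorem dirDeriv_divC_left (R : E) :
    dirDeriv (divC E G) (idPt E G, idPt E G) (R, 0) = R := by
  apply HasDirDeriv.dirDeriv_eq
  apply hasDirDeriv_of_eventually_eq
  filter_upwards [(isOpen_divDom (E := E) (G := G)).mem_nhds idPt_mem_divDom] with y hy t ht
  have hy' := hy.1.1
  subst ht
  simp only [Prod.smul_mk, Prod.mk_add_mk, smul_zero, add_zero] at hy' ⊢
  simp only [divC, mulC, invC, symm_idPt, inv_one, mul_one, (idChart E G).right_inv hy']

theorem Lead.coord_eq (hh : Tendsto h l (𝓝[≠] 0)) : ∀ᶠ i in l,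
    idPt E G + h i • (h i)⁻¹ • (idChart E G (g i) - idPt E G) = idChart E G (g i) := by
  filter_upwards [(tendsto_nhdsWithin_iff.1 hh).2] with i hi
  rw [smul_inv_smul₀ hi, add_sub_cancel]

/-- Right multiplication by elements near 1 has partial derivative the identity at (e, e), and
strict differentiability allows the left factor b to vary with i. -/
theorem Lead.tendsto_left_mul (hh : Tendsto h l (𝓝[≠] 0)) (hg : Lead l h g R)
    (hb : Tendsto b l (𝓝 1)) :
    Tendsto (fun i => (h i)⁻¹ • (idChart E G (b i * g i) - idChart E G (b i))) l (𝓝 R) := by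
  have := smoothOn_mulC.tendsto isOpen_mulDom (idPt_mem_mulDom (E := E) (G := G))
    ((tendsto_idChart hb).prodMk_nhds tendsto_const_nhds)
    ((tendsto_const_nhds (x := (0 : E))).prodMk_nhds hg.tendsto_quot) hh
  rw [dirDeriv_mulC_right] at this
  refine this.congr' ?_
  filter_upwards [Lead.coord_eq (E := E) (g := g) hh, eventually_mem_source (E := E) hg.tendsto_one,
    eventually_mem_source (E := E) hb] with i h1 h2 h3
  simp only [Prod.smul_mk, Prod.mk_add_mk, smul_zero, add_zero, h1, mulC_idChart h3 h2]
  rw [mulC_idChart h3 (mem_chart_source E 1), mul_one]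

/-- Passes from coordinate differences to group quotients: g b⁻¹ is compared with b b⁻¹ = 1, and
division has partial derivative the identity in its first argument at (e, e). -/
theorem Lead.of_sub (hh : Tendsto h l (𝓝[≠] 0)) (hg : Tendsto g l (𝓝 1))
    (hb : Tendsto b l (𝓝 1))
    (hq : Tendsto (fun i => (h i)⁻¹ • (idChart E G (g i) - idChart E G (b i))) l (𝓝 R)) :
    Lead l h (fun i => g i * (b i)⁻¹) R := by
  have := isTopologicalGroup E G
  refine ⟨tendsto_mul_one hg (tendsto_inv_one hb), ?_⟩
  have := smoothOn_divC.tendsto isOpen_divDom (idPt_mem_divDom (E := E) (G := G))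
    ((tendsto_idChart hb).prodMk_nhds (tendsto_idChart hb))
    (hq.prodMk_nhds (tendsto_const_nhds (x := (0 : E)))) hh
  rw [dirDeriv_divC_left] at this
  refine this.congr' ?_
  filter_upwards [(tendsto_nhdsWithin_iff.1 hh).2, eventually_mem_source (E := E) hg,
    eventually_mem_source (E := E) hb,
    eventually_mem_source (E := E) (tendsto_inv_one hb)] with i h1 h2 h3 h4
  simp only [Prod.smul_mk, Prod.mk_add_mk, smul_zero, add_zero, smul_inv_smul₀ h1,
    add_sub_cancel, divC_idChart h3 h3 h4, divC_idChart h2 h3 h4, mul_inv_cancel]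

theorem Lead.one : Lead l h (fun _ => (1 : G)) (0 : E) :=
  ⟨tendsto_const_nhds, by simp [tendsto_const_nhds]⟩

theorem Lead.mul (hh : Tendsto h l (𝓝[≠] 0)) (hg : Lead l h g R) (hg' : Lead l h g' S) :
    Lead l h (fun i => g i * g' i) (R + S) := by
  have := isTopologicalGroup E G
  refine ⟨tendsto_mul_one hg.tendsto_one hg'.tendsto_one, ?_⟩
  refine (hg.tendsto_quot.add (hg'.tendsto_left_mul hh hg.tendsto_one)).congr fun i => ?_
  rw [← smul_add]
  congr 1
  abel

theorem Lead.inv (hh : Tendsto h l (𝓝[≠] 0)) (hg : Lead l h g R) :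
    Lead l h (fun i => (g i)⁻¹) (-R) := by
  have := Lead.of_sub (R := -R) hh tendsto_const_nhds hg.tendsto_one
    (hg.tendsto_quot.neg.congr fun i => by rw [← smul_neg, neg_sub])
  simpa using this

theorem Lead.conj (hh : Tendsto h l (𝓝[≠] 0)) (hg : Lead l h g R) (hb : Tendsto b l (𝓝 1)) :
    Lead l h (fun i => b i * g i * (b i)⁻¹) R :=
  have := isTopologicalGroup E G
  Lead.of_sub hh (tendsto_mul_one hb hg.tendsto_one) hb (hg.tendsto_left_mul hh hb)

theorem Lead.tendsto_secondDiff (hh : Tendsto h l (𝓝[≠] 0)) (hh' : Tendsto h' l (𝓝[≠] 0))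
    (hg : Lead l h g R) (hg' : Lead l h' g' S) :
    Tendsto (fun i => (h i * h' i)⁻¹ • (idChart E G (g i * g' i) - idChart E G (g' i) -
      (idChart E G (g i) - idPt E G))) l
      (𝓝 (dirDeriv (leftInvariantField (E := E) (G := G) S) (idPt E G) R)) := by
  have := smoothOn_mulC.tendsto_secondDiff isOpen_mulDom (idPt_mem_mulDom (E := E) (G := G))
    tendsto_const_nhds hg.tendsto_quot tendsto_const_nhds hg'.tendsto_quot hh hh'
  have e : dirDeriv (fun p : (E × E) × (E × E) => dirDeriv (mulC E G) p.1 p.2)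
      ((idPt E G, idPt E G), (0, S)) ((R, 0), (0, 0)) =
      dirDeriv (leftInvariantField (E := E) (G := G) S) (idPt E G) R := by
    -- Differentiating multiplication in its second factor at e is by definition the left invariant
    -- field, so the mixed second derivative is a derivative of that field.
    have e1 : ∀ x : E, dirDeriv (mulC E G) (x, idPt E G) (0, S) =
        leftInvariantField (E := E) (G := G) S x := fun x => by
      simp [leftInvariantField, dirDeriv, mulC]
    simp only [dirDeriv.eq_1 (fun p : (E × E) × (E × E) => dirDeriv (mulC E G) p.1 p.2),
      Prod.smul_mk, Prod.mk_add_mk, smul_zero, add_zero, e1]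
    rfl
  rw [e] at this
  refine this.congr' ?_
  filter_upwards [Lead.coord_eq (E := E) (g := g) hh, Lead.coord_eq (E := E) (g := g') hh',
    eventually_mem_source (E := E) hg.tendsto_one,
    eventually_mem_source (E := E) hg'.tendsto_one] with i h1 h2 h3 h4
  rw [h1, h2, mulC_idChart h3 h4, mulC_idChart (mem_chart_source E 1) h4,
    mulC_idChart h3 (mem_chart_source E 1),
    mulC_idChart (mem_chart_source E 1) (mem_chart_source E 1)]
  simp

/-- In the difference of the two second differences, of g g' and of g' g, all first-order terms
cancel. What remains is κ(g g') - κ(g' g), and the limits subtract to the bracket. -/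
theorem Lead.commutator (hh : Tendsto h l (𝓝[≠] 0)) (hh' : Tendsto h' l (𝓝[≠] 0))
    (hg : Lead l h g R) (hg' : Lead l h' g' S) :
    Lead l (fun i => h i * h' i) (fun i => g i * g' i * (g' i * g i)⁻¹)
      (lieBracket (E := E) (G := G) R S) := by
  have := isTopologicalGroup E G
  have hhh : Tendsto (fun i => h i * h' i) l (𝓝[≠] 0) := by
    rw [tendsto_nhdsWithin_iff] at *
    refine ⟨by simpa using hh.1.mul hh'.1, ?_⟩
    filter_upwards [hh.2, hh'.2] with i h1 h2 using mul_ne_zero h1 h2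
  refine Lead.of_sub hhh (tendsto_mul_one hg.tendsto_one hg'.tendsto_one)
    (tendsto_mul_one hg'.tendsto_one hg.tendsto_one) ?_
  refine ((hg.tendsto_secondDiff hh hh' hg').sub
    (hg'.tendsto_secondDiff hh' hh hg)).congr fun i => ?_
  rw [mul_comm (h' i), ← smul_sub]
  congr 1
  abel

theorem Lead.comp {κ : Type*} {m : Filter κ} {f : κ → ι} (hg : Lead l h g R)
    (hf : Tendsto f m l) : Lead m (fun i => h (f i)) (fun i => g (f i)) R :=
  ⟨hg.tendsto_one.comp hf, hg.tendsto_quot.comp hf⟩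

theorem Lead.rescale (hg : Lead l h g R) {c : ℝ} (hc : ∀ᶠ i in l, c * h' i = h i)
    (hc0 : c ≠ 0) : Lead l h' g (c • R) := by
  refine ⟨hg.tendsto_one, (hg.tendsto_quot.const_smul c).congr' ?_⟩
  filter_upwards [hc] with i hi
  rw [← hi, smul_smul]
  congr 1
  rw [mul_inv, mul_inv_cancel_left₀ hc0]

end Lead

/-! ### Smooth germs of curves at the identity and their leading coefficients. -/

section Germs

variable {E : Type*} [AddCommGroup E] [Module ℝ E] [TopologicalSpace E]
  [IsTopologicalAddGroup E] [ContinuousSMul ℝ E] [LocallyConvexSpace ℝ E] [T2Space E]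
  {G : Type*} [TopologicalSpace G] [ChartedSpace E G] [Group G] [LieGroup E G]

theorem exists_Ioo_of_eventually {P : ℝ → Prop} (h : ∀ᶠ t in 𝓝 0, P t) :
    ∃ r > 0, ∀ t ∈ Ioo (-r) r, P t := by
  obtain ⟨r, hr, h⟩ := Metric.eventually_nhds_iff_ball.1 h
  refine ⟨r, hr, fun t ht => h t ?_⟩
  rwa [Real.ball_eq_Ioo, zero_sub, zero_add]

theorem eventually_mem_Ioo {r : ℝ} (hr : 0 < r) : ∀ᶠ t in 𝓝 (0 : ℝ), t ∈ Ioo (-r) r :=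
  Ioo_mem_nhds (by linarith) hr

/-- The translation by w is handled by smoothness of multiplication, with w as a constant point of
its own chart. It permits curves far from the identity, as needed for `stepPath`. -/
theorem smoothCurveOn_of_chart {φ : ℝ → G} {c : ℝ → E} {O : Set ℝ} (w : G) (hO : IsOpen O)
    (hc : SmoothOn c O) (hcO : MapsTo c O (idChart E G).target)
    (hφ : ∀ t ∈ O, φ t = w * (idChart E G).symm (c t)) : SmoothCurveOn E φ O := by
  have := isTopologicalGroup E G
  have hφc : ContinuousOn φ O :=
    (continuousOn_const.mul ((idChart E G).symm.continuousOn.comp hc.continuousOn hcO)).congr hφ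
  refine ⟨hφc, fun e he => ?_⟩
  have hO' : IsOpen (O ∩ φ ⁻¹' e.source) := hφc.isOpen_inter_preimage hO e.open_source
  have hV : IsOpen (((chartAt E w).target ×ˢ (idChart E G).target) ∩
      {p : E × E | (chartAt E w).symm p.1 * (idChart E G).symm p.2 ∈ e.source}) := by
    have hc : ContinuousOn (fun p : E × E => (chartAt E w).symm p.1 * (idChart E G).symm p.2)
        ((chartAt E w).target ×ˢ (idChart E G).target) :=
      ((chartAt E w).symm.continuousOn.comp continuousOn_fst fun p hp => hp.1).mul
        ((idChart E G).symm.continuousOn.comp continuousOn_snd fun p hp => hp.2)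
    exact hc.isOpen_inter_preimage ((chartAt E w).open_target.prod (idChart E G).open_target)
      e.open_source
  have hw : (chartAt E w).symm (chartAt E w w) = w :=
    (chartAt E w).left_inv (mem_chart_source E w)
  have := SmoothOn.comp (g := fun t : ℝ => (chartAt E w w, c t))
    (LieGroup.smooth_mul _ (chart_mem_atlas E w) _ (chart_mem_atlas E (1 : G)) e he)
    ((smoothOn_const _ _).prodMk (hc.mono inter_subset_left)) hV (U := O ∩ φ ⁻¹' e.source)
    (fun t ht => ⟨⟨(chartAt E w).map_source (mem_chart_source E w), hcO ht.1⟩, by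
      have h2 := ht.2
      rw [mem_preimage, hφ t ht.1] at h2
      simpa [hw] using h2⟩) hO'
  refine this.congr hO' fun t ht => ?_
  simp only [hw, hφ t ht.1]

variable (E) in
/-- `φ 0 = 1` and `φ` is smooth near `0`. -/
def SmoothGerm (φ : ℝ → G) : Prop :=
  φ 0 = 1 ∧ ∃ r > 0, MapsTo φ (Ioo (-r) r) (idChart E G).source ∧
    SmoothOn (fun t => idChart E G (φ t)) (Ioo (-r) r)

theorem SmoothGerm.tendsto {φ : ℝ → G} (h : SmoothGerm E φ) : Tendsto φ (𝓝 0) (𝓝 1) := by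
  obtain ⟨h0, r, hr, h1, h2⟩ := h
  have hm : Ioo (-r) r ∈ 𝓝 (0 : ℝ) := Ioo_mem_nhds (by linarith) hr
  have := (h2.continuousOn.continuousAt hm).tendsto
  rw [h0] at this
  refine (tendsto_idChart_symm this).congr' ?_
  filter_upwards [hm] with t ht using (idChart E G).left_inv (h1 ht)

theorem SmoothGerm.smoothCurveOn {φ : ℝ → G} (h : SmoothGerm E φ) :
    ∃ r > 0, SmoothCurveOn E φ (Ioo (-r) r) := by
  obtain ⟨h0, r, hr, h1, h2⟩ := h
  exact ⟨r, hr, smoothCurveOn_of_chart 1 isOpen_Ioo h2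
    (fun t ht => (idChart E G).map_source (h1 ht))
    fun t ht => by rw [one_mul, (idChart E G).left_inv (h1 ht)]⟩

theorem SmoothCurveOn.mono {φ : ℝ → G} {I J : Set ℝ} (h : SmoothCurveOn E φ I) (hJ : J ⊆ I) :
    SmoothCurveOn E φ J :=
  ⟨h.1.mono hJ, fun e he => (h.2 e he).mono (inter_subset_inter_left _ hJ)⟩

theorem SmoothCurveOn.smoothGerm {φ : ℝ → G} {I : Set ℝ} (h : SmoothCurveOn E φ I)
    (hI : I ∈ 𝓝 0) (h0 : φ 0 = 1) : SmoothGerm E φ := by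
  have h1 : Tendsto φ (𝓝 0) (𝓝 1) := h0 ▸ h.1.continuousAt hI
  obtain ⟨r, hr, h2⟩ := exists_Ioo_of_eventually
    ((h1.eventually (source_mem_nhds_one (E := E))).and hI)
  exact ⟨h0, r, hr, fun t ht => (h2 t ht).1, (h.2 _ (chart_mem_atlas E 1)).mono
    fun t ht => ⟨(h2 t ht).2, (h2 t ht).1⟩⟩

theorem SmoothGerm.one : SmoothGerm E fun _ => (1 : G) :=
  ⟨rfl, 1, one_pos, fun _ _ => mem_chart_source E 1, smoothOn_const _ _⟩

theorem SmoothGerm.div {φ ψ : ℝ → G} (hφ : SmoothGerm E φ) (hψ : SmoothGerm E ψ) :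
    SmoothGerm E fun t => φ t * (ψ t)⁻¹ := by
  have := isTopologicalGroup E G
  have t1 := hφ.tendsto
  have t2 := hψ.tendsto
  obtain ⟨h0, r, hr, h1, h2⟩ := hφ
  obtain ⟨k0, s, hs, k1, k2⟩ := hψ
  obtain ⟨q, hq, h3⟩ := exists_Ioo_of_eventually
    (((eventually_mem_Ioo hr).and (eventually_mem_Ioo hs)).and
      ((eventually_mem_source (E := E) (tendsto_inv_one t2)).and
      (eventually_mem_source (E := E) (tendsto_mul_one t1 (tendsto_inv_one t2)))))
  refine ⟨by simp [h0, k0], q, hq, fun t ht => (h3 t ht).2.2, ?_⟩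
  refine ((smoothOn_divC (E := E) (G := G)).comp
    ((h2.mono fun t ht => (h3 t ht).1.1).prodMk (k2.mono fun t ht => (h3 t ht).1.2))
    isOpen_divDom (fun t ht => ?_) isOpen_Ioo).congr isOpen_Ioo fun t ht => ?_
  · obtain ⟨⟨a1, a2⟩, a3, a4⟩ := h3 t ht
    exact mem_divDom (h1 a1) (k1 a2) a3 a4
  · obtain ⟨⟨a1, a2⟩, a3, a4⟩ := h3 t ht
    exact divC_idChart (h1 a1) (k1 a2) a3

theorem SmoothGerm.inv {φ : ℝ → G} (hφ : SmoothGerm E φ) : SmoothGerm E fun t => (φ t)⁻¹ := by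
  simpa using SmoothGerm.one.div hφ

theorem SmoothGerm.mul {φ ψ : ℝ → G} (hφ : SmoothGerm E φ) (hψ : SmoothGerm E ψ) :
    SmoothGerm E fun t => φ t * ψ t := by
  simpa using hφ.div hψ.inv

theorem SmoothGerm.comp {φ : ℝ → G} (hφ : SmoothGerm E φ) {ρ : ℝ → ℝ}
    (hρ : SmoothOn ρ univ) (h0 : ρ 0 = 0) : SmoothGerm E fun t => φ (ρ t) := by
  obtain ⟨k0, r, hr, h1, h2⟩ := hφ
  have hc : ContinuousAt ρ 0 := hρ.continuousOn.continuousAt univ_mem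
  have hm : Ioo (-r) r ∈ 𝓝 (ρ 0) := by rw [h0]; exact Ioo_mem_nhds (by linarith) hr
  obtain ⟨q, hq, h3⟩ := exists_Ioo_of_eventually (hc.eventually hm)
  exact ⟨by simp [h0, k0], q, hq, fun t ht => h1 (h3 t ht),
    h2.comp (hρ.mono (subset_univ _)) isOpen_Ioo h3 isOpen_Ioo⟩

theorem smoothOn_pow (k : ℕ) : SmoothOn (fun t : ℝ => t ^ k) univ :=
  smoothOn_of_contDiff fun _ => contDiff_id.pow k

theorem smoothOn_const_mul (c : ℝ) : SmoothOn (fun t : ℝ => c * t) univ :=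
  smoothOn_of_contDiff fun _ => contDiff_const.mul contDiff_id

theorem tendsto_pow_punctured {k : ℕ} (hk : 1 ≤ k) :
    Tendsto (fun t : ℝ => t ^ k) (𝓝[≠] 0) (𝓝[≠] 0) := by
  refine tendsto_nhdsWithin_iff.2 ⟨?_, ?_⟩
  · have := ((continuous_pow k).tendsto (0 : ℝ)).mono_left (nhdsWithin_le_nhds (s := {0}ᶜ))
    rwa [zero_pow (by omega)] at this
  · filter_upwards [self_mem_nhdsWithin] with t ht using pow_ne_zero k ht

theorem tendsto_const_mul_punctured {c : ℝ} (hc : c ≠ 0) :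
    Tendsto (fun t : ℝ => c * t) (𝓝[≠] 0) (𝓝[≠] 0) := by
  refine tendsto_nhdsWithin_iff.2 ⟨?_, ?_⟩
  · simpa using ((continuous_const_mul c).tendsto (0 : ℝ)).mono_left
      (nhdsWithin_le_nhds (s := {0}ᶜ))
  · filter_upwards [self_mem_nhdsWithin] with t ht using mul_ne_zero hc ht

theorem Lead.comp_const_mul {φ : ℝ → G} {k : ℕ} {X : E}
    (h : Lead (𝓝[≠] 0) (fun t => t ^ k) φ X) {c : ℝ} (hc : c ≠ 0) :
    Lead (𝓝[≠] 0) (fun t => t ^ k) (fun t => φ (c * t)) (c ^ k • X) := by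
  refine (h.comp (tendsto_const_mul_punctured hc)).rescale (Eventually.of_forall fun t => ?_)
    (pow_ne_zero _ hc)
  rw [mul_pow]

theorem Lead.comp_pow {φ : ℝ → G} {k : ℕ} {X : E}
    (h : Lead (𝓝[≠] 0) (fun t => t ^ k) φ X) {m : ℕ} (hm : 1 ≤ m) :
    Lead (𝓝[≠] 0) (fun t => t ^ (m * k)) (fun t => φ (t ^ m)) X := by
  simpa only [pow_mul] using h.comp (tendsto_pow_punctured hm)

theorem SmoothGerm.lead_iff {φ : ℝ → G} (hφ : SmoothGerm E φ) {h : ℝ → ℝ} {X : E} :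
    Lead (𝓝[≠] 0) h φ X ↔
    Tendsto (fun t => (h t)⁻¹ • (idChart E G (φ t) - idChart E G (φ 0))) (𝓝[≠] 0) (𝓝 X) := by
  rw [hφ.1]
  exact ⟨fun h => h.2, fun h => ⟨hφ.tendsto.mono_left nhdsWithin_le_nhds, h⟩⟩

theorem SmoothGerm.lead_of_order {φ : ℝ → G} (hφ : SmoothGerm E φ) {k : ℕ} (hk : 1 ≤ k)
    (h : ∀ j, 1 ≤ j → j < k → curveDeriv^[j] (fun t => idChart E G (φ t)) 0 = 0) :
    Lead (𝓝[≠] 0) (fun t => t ^ k) φ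
      ((k.factorial : ℝ)⁻¹ • curveDeriv^[k] (fun t => idChart E G (φ t)) 0) := by
  obtain ⟨-, r, hr, -, h2⟩ := id hφ
  exact hφ.lead_iff.2 (tendsto_taylor hr hk h2 h)

theorem SmoothGerm.iterate_curveDeriv {φ : ℝ → G} (hφ : SmoothGerm E φ) {k : ℕ} {X : E}
    (h : Lead (𝓝[≠] 0) (fun t => t ^ k) φ X) {j : ℕ} (hj : 1 ≤ j) (hjk : j ≤ k) :
    curveDeriv^[j] (fun t => idChart E G (φ t)) 0 =
      if j = k then (k.factorial : ℝ) • X else 0 := by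
  obtain ⟨-, r, hr, -, h2⟩ := id hφ
  exact iterate_curveDeriv_eq_of_tendsto hr h2 (hφ.lead_iff.1 h) hj hjk

/-- A zero coefficient at order k makes all derivatives of orders 1 to k vanish, so Taylor's formula
provides a coefficient, possibly zero, at order k + 1. -/
theorem SmoothGerm.exists_lead_succ {φ : ℝ → G} (hφ : SmoothGerm E φ) {k : ℕ}
    (h : Lead (𝓝[≠] 0) (fun t => t ^ k) φ (0 : E)) :
    ∃ R : E, Lead (𝓝[≠] 0) (fun t => t ^ (k + 1)) φ R := by
  refine ⟨_, hφ.lead_of_order (by omega) fun j hj hjk => ?_⟩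
  rw [hφ.iterate_curveDeriv h hj (by omega)]
  simp

/-! ### The tangent set -/

variable {H : Subgroup G}

/-- `X` is the leading coefficient of a smooth germ with values in `H`. -/
def IsLeadingIn (H : Subgroup G) (X : E) : Prop :=
  ∃ (φ : ℝ → G) (k : ℕ), 1 ≤ k ∧ SmoothGerm E φ ∧ (∀ᶠ t in 𝓝 0, φ t ∈ H) ∧
    Lead (𝓝[≠] 0) (fun t => t ^ k) φ X

theorem eventually_comp {P : ℝ → Prop} (h : ∀ᶠ t in 𝓝 0, P t) {ρ : ℝ → ℝ}
    (hρ : SmoothOn ρ univ) (h0 : ρ 0 = 0) : ∀ᶠ t in 𝓝 0, P (ρ t) := by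
  have hc : ContinuousAt ρ 0 := hρ.continuousOn.continuousAt univ_mem
  exact hc.eventually (h0.symm ▸ h)

/-- Slowing or speeding time by c^(1/k) multiplies a coefficient of order k by c. Negative factors
come from inversion, since even k gives no sign change. -/
theorem IsLeadingIn.pos_smul {X : E} (h : IsLeadingIn H X) {c : ℝ} (hc : 0 < c) :
    IsLeadingIn H (c • X) := by
  obtain ⟨φ, k, hk, h1, h2, h3⟩ := h
  have h4 : (c ^ (k⁻¹ : ℝ)) ^ k = c := Real.rpow_inv_natCast_pow hc.le (by omega)
  have h5 : c ^ (k⁻¹ : ℝ) ≠ 0 := (Real.rpow_pos_of_pos hc _).ne'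
  refine ⟨fun t => φ (c ^ (k⁻¹ : ℝ) * t), k, hk, h1.comp (smoothOn_const_mul _) (by simp),
    eventually_comp h2 (smoothOn_const_mul _) (by simp), ?_⟩
  have := h3.comp_const_mul h5
  rwa [h4] at this

/-- The k-th derivative and the leading coefficient differ by k!, which a linear change of time
absorbs in either direction. -/
theorem mem_tangentSet_iff {X : E} : X ∈ tangentSet E H ↔ IsLeadingIn H X := by
  constructor
  · rintro ⟨a, b, φ, k, ha, hb, hk, h1, h2, h3, h4, h5⟩
    have hI : Ioo a b ∈ 𝓝 (0 : ℝ) := Ioo_mem_nhds ha hb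
    have hφ := h1.smoothGerm hI h3
    have hk0 : (0 : ℝ) < k.factorial := by positivity
    have : IsLeadingIn H ((k.factorial : ℝ)⁻¹ • X) :=
      ⟨φ, k, hk, hφ, mem_of_superset hI h2, h5 ▸ hφ.lead_of_order hk h4⟩
    simpa [smul_smul, hk0.ne'] using this.pos_smul hk0
  · intro h
    obtain ⟨φ, k, hk, h1, h2, h3⟩ := id h
    have hk0 : (0 : ℝ) < k.factorial := by positivity
    obtain ⟨ψ, m, hm, h1, h2, h3⟩ : ∃ ψ : ℝ → G, ∃ m, 1 ≤ m ∧ SmoothGerm E ψ ∧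
        (∀ᶠ t in 𝓝 0, ψ t ∈ H) ∧ Lead (𝓝[≠] 0) (fun t => t ^ m) ψ ((m.factorial : ℝ)⁻¹ • X) := by
      have h4 : (((k.factorial : ℝ)⁻¹) ^ (k⁻¹ : ℝ)) ^ k = (k.factorial : ℝ)⁻¹ :=
        Real.rpow_inv_natCast_pow (by positivity) (by omega)
      refine ⟨fun t => φ (((k.factorial : ℝ)⁻¹) ^ (k⁻¹ : ℝ) * t), k, hk,
        h1.comp (smoothOn_const_mul _) (by simp),
        eventually_comp h2 (smoothOn_const_mul _) (by simp), ?_⟩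
      have := h3.comp_const_mul (c := ((k.factorial : ℝ)⁻¹) ^ (k⁻¹ : ℝ))
        (Real.rpow_pos_of_pos (by positivity) _).ne'
      rwa [h4] at this
    have hm0 : (m.factorial : ℝ) ≠ 0 := by positivity
    obtain ⟨r, hr, h4⟩ := h1.smoothCurveOn
    obtain ⟨s, hs, h5⟩ := exists_Ioo_of_eventually
      (h2.and (eventually_mem_Ioo hr))
    refine ⟨-s, s, ψ, m, by linarith, hs, hm, h4.mono fun t ht => (h5 t ht).2,
      fun t ht => (h5 t ht).1, h1.1, fun j hj hjm => ?_, ?_⟩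
    · rw [h1.iterate_curveDeriv h3 hj hjm.le, if_neg hjm.ne]
    · rw [h1.iterate_curveDeriv h3 hm le_rfl, if_pos rfl, smul_inv_smul₀ hm0]

theorem IsLeadingIn.zero : IsLeadingIn H (0 : E) :=
  ⟨fun _ => 1, 1, le_rfl, SmoothGerm.one, Eventually.of_forall fun _ => H.one_mem, Lead.one⟩

theorem IsLeadingIn.neg {X : E} (h : IsLeadingIn H X) : IsLeadingIn H (-X) := by
  obtain ⟨φ, k, hk, h1, h2, h3⟩ := h
  exact ⟨_, k, hk, h1.inv, h2.mono fun t ht => H.inv_mem ht, h3.inv (tendsto_pow_punctured hk)⟩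

/-- The substitutions t ↦ t^m and t ↦ t^k bring both germs to the common order mk without changing
their coefficients. -/
theorem IsLeadingIn.add {X Y : E} (hX : IsLeadingIn H X) (hY : IsLeadingIn H Y) :
    IsLeadingIn H (X + Y) := by
  obtain ⟨φ, k, hk, h1, h2, h3⟩ := hX
  obtain ⟨ψ, m, hm, k1, k2, k3⟩ := hY
  have hkm : 1 ≤ m * k := Nat.mul_pos hm hk
  refine ⟨fun t => φ (t ^ m) * ψ (t ^ k), m * k, hkm,
    (h1.comp (smoothOn_pow m) (zero_pow (by omega))).mul
      (k1.comp (smoothOn_pow k) (zero_pow (by omega))), ?_,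
    (h3.comp_pow hm).mul (tendsto_pow_punctured hkm) (mul_comm k m ▸ k3.comp_pow hk)⟩
  filter_upwards [eventually_comp h2 (smoothOn_pow m) (zero_pow (by omega)),
    eventually_comp k2 (smoothOn_pow k) (zero_pow (by omega))] with t a b using H.mul_mem a b

theorem IsLeadingIn.smul {X : E} (h : IsLeadingIn H X) (c : ℝ) : IsLeadingIn H (c • X) := by
  rcases lt_trichotomy c 0 with hc | rfl | hc
  · simpa using (h.pos_smul (neg_pos.2 hc)).neg
  · simpa using IsLeadingIn.zero
  · exact h.pos_smul hc

theorem IsLeadingIn.lieBracket {X Y : E} (hX : IsLeadingIn H X) (hY : IsLeadingIn H Y) :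
    IsLeadingIn H (LCLie.lieBracket (E := E) (G := G) X Y) := by
  obtain ⟨φ, k, hk, h1, h2, h3⟩ := hX
  obtain ⟨ψ, m, hm, k1, k2, k3⟩ := hY
  refine ⟨fun t => φ t * ψ t * (ψ t * φ t)⁻¹, k + m, by omega, (h1.mul k1).div (k1.mul h1), ?_, ?_⟩
  · filter_upwards [h2, k2] with t a b
    exact H.mul_mem (H.mul_mem a b) (H.inv_mem (H.mul_mem b a))
  · simpa only [pow_add] using
      h3.commutator (tendsto_pow_punctured hk) (tendsto_pow_punctured hm) k3

theorem exists_submodule_tangentSet (H : Subgroup G) :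
    ∃ S : Submodule ℝ (LieAlg E G), (S : Set (LieAlg E G)) = tangentSet E H ∧
      ∀ X ∈ S, ∀ Y ∈ S, LCLie.lieBracket (E := E) (G := G) X Y ∈ S :=
  ⟨{ carrier := tangentSet E H
     add_mem' := fun ha hb => mem_tangentSet_iff.2
       ((mem_tangentSet_iff.1 ha).add (mem_tangentSet_iff.1 hb))
     zero_mem' := mem_tangentSet_iff.2 IsLeadingIn.zero
     smul_mem' := fun c _ hx => mem_tangentSet_iff.2 ((mem_tangentSet_iff.1 hx).smul c) }, rfl,
    fun _ hX _ hY => mem_tangentSet_iff.2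
      ((mem_tangentSet_iff.1 hX).lieBracket (mem_tangentSet_iff.1 hY))⟩

end Germs

/-! ### Approximation of one-parameter subgroups by germs in H to arbitrary order. -/

section Approximation

variable {E : Type*} [AddCommGroup E] [Module ℝ E] [TopologicalSpace E]
  [IsTopologicalAddGroup E] [ContinuousSMul ℝ E] [LocallyConvexSpace ℝ E] [T2Space E]
  {G : Type*} [TopologicalSpace G] [ChartedSpace E G] [Group G] [LieGroup E G]
  {γ : ℝ → G} {X : E} {H : Subgroup G}

theorem IsOneParameterSubgroup.map_zero (hγ : IsOneParameterSubgroup γ X) : γ 0 = 1 := by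
  simpa using hγ.2.1 0 0

theorem IsOneParameterSubgroup.map_neg (hγ : IsOneParameterSubgroup γ X) (t : ℝ) :
    γ (-t) = (γ t)⁻¹ := by
  rw [eq_inv_iff_mul_eq_one, ← hγ.2.1, neg_add_cancel, hγ.map_zero]

theorem IsOneParameterSubgroup.map_sub (hγ : IsOneParameterSubgroup γ X) (s t : ℝ) :
    γ (s - t) = γ s * (γ t)⁻¹ := by
  rw [sub_eq_add_neg, hγ.2.1, hγ.map_neg]

theorem IsOneParameterSubgroup.map_nat_mul (hγ : IsOneParameterSubgroup γ X) (n : ℕ) (t : ℝ) :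
    γ (n * t) = γ t ^ n := by
  induction n with
  | zero => simp [hγ.map_zero]
  | succ n ih => rw [Nat.cast_succ, add_mul, one_mul, hγ.2.1, ih, pow_succ]

theorem IsOneParameterSubgroup.smoothGerm (hγ : IsOneParameterSubgroup γ X) : SmoothGerm E γ :=
  hγ.1.smoothGerm univ_mem hγ.map_zero

theorem IsOneParameterSubgroup.continuous (hγ : IsOneParameterSubgroup γ X) : Continuous γ :=
  continuousOn_univ.1 hγ.1.1

theorem IsOneParameterSubgroup.lead (hγ : IsOneParameterSubgroup γ X) :
    Lead (𝓝[≠] 0) (fun t => t ^ 1) γ X := by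
  refine hγ.smoothGerm.lead_iff.2 ?_
  simpa [HasDirDeriv] using hγ.2.2

/-- The coefficients of the triple jump that cancels an error term of order `p`. -/
theorem exists_tripleJump {k p : ℕ} (hk : 1 ≤ k) (hkp : k < p) :
    ∃ a b : ℝ, a ≠ 0 ∧ b ≠ 0 ∧ a ^ k + a ^ k - b ^ k = 1 ∧ a ^ p + a ^ p - b ^ p = 0 := by
  -- With b = βa and β^p = 2 the order-p condition holds automatically. Since k < p, β^k < 2, so a
  -- can be chosen to normalise order k.
  set β : ℝ := 2 ^ (p⁻¹ : ℝ) with hβ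
  have h1 : β ^ p = 2 := Real.rpow_inv_natCast_pow (by norm_num) (by omega)
  have h2 : 1 < β := Real.one_lt_rpow (by norm_num) (by
    have : (0 : ℝ) < p := by exact_mod_cast (by omega : 0 < p)
    positivity)
  have h3 : 0 < 2 - β ^ k := by
    have := pow_lt_pow_right₀ h2 hkp
    linarith
  set a : ℝ := ((2 - β ^ k)⁻¹) ^ (k⁻¹ : ℝ) with ha
  have h4 : a ^ k = (2 - β ^ k)⁻¹ := Real.rpow_inv_natCast_pow (by positivity) (by omega)
  have h5 : 0 < a := Real.rpow_pos_of_pos (by positivity) _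
  refine ⟨a, β * a, h5.ne', (mul_pos (by linarith) h5).ne', ?_, ?_⟩
  · rw [mul_pow, h4]
    field_simp
    ring
  · rw [mul_pow, h1]
    ring

/-- A one-parameter subgroup whose velocity is tangent to `H` is approximated to arbitrary order
by germs with values in `H`. -/
theorem IsLeadingIn.exists_approx (hX : IsLeadingIn H X) (hγ : IsOneParameterSubgroup γ X) :
    ∃ k, 1 ≤ k ∧ ∀ p, k < p → ∃ (ψ : ℝ → G) (R : E), SmoothGerm E ψ ∧ (∀ᶠ t in 𝓝 0, ψ t ∈ H) ∧
      Lead (𝓝[≠] 0) (fun t => t ^ p) (fun t => ψ t * (γ (t ^ k))⁻¹) R := by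
  obtain ⟨φ, k, hk, h1, h2, h3⟩ := hX
  have hγk : SmoothGerm E fun t => γ (t ^ k) :=
    hγ.smoothGerm.comp (smoothOn_pow k) (zero_pow (by omega))
  have hγt : Tendsto (fun t => γ (t ^ k)) (𝓝[≠] 0) (𝓝 1) :=
    hγk.tendsto.mono_left nhdsWithin_le_nhds
  refine ⟨k, hk, fun p hp => ?_⟩
  induction p, (show k + 1 ≤ p from hp) using Nat.le_induction with
  | base =>
    have h4 : Lead (𝓝[≠] 0) (fun t => t ^ k) (fun t => (γ (t ^ k))⁻¹) (-X) := by
      simpa using (hγ.lead.comp_pow hk).inv (by simpa using tendsto_pow_punctured hk)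
    have h5 := h3.mul (tendsto_pow_punctured hk) h4
    rw [add_neg_cancel] at h5
    obtain ⟨R, hR⟩ := (h1.div hγk).exists_lead_succ h5
    exact ⟨φ, R, h1, h2, hR⟩
  | succ p hp' ih =>
    obtain ⟨ψ, R, k1, k2, k3⟩ := ih hp'
    obtain ⟨a, b, ha, hb, hab, hab'⟩ := exists_tripleJump hk hp'
    have ga : SmoothGerm E fun t => ψ (a * t) := k1.comp (smoothOn_const_mul a) (by simp)
    have gb : SmoothGerm E fun t => ψ (b * t) := k1.comp (smoothOn_const_mul b) (by simp)
    have hpt := tendsto_pow_punctured (k := p) (by omega)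
    have la := k3.comp_const_mul ha
    have lb := k3.comp_const_mul hb
    have ta : Tendsto (fun t => γ ((a * t) ^ k)) (𝓝[≠] 0) (𝓝 1) :=
      hγt.comp (tendsto_const_mul_punctured ha)
    -- With ε(t) = ψ(t)γ(t^k)⁻¹, the new error is ε(at) · γ((at)^k) ε(at) γ((at)^k)⁻¹ · γ(t^k)
    -- ε(bt)⁻¹ γ(t^k)⁻¹. Conjugation by elements tending to 1 keeps leading coefficients, so that of
    -- the product is (2a^p - b^p)R = 0.
    have l1 := (la.mul hpt (la.conj hpt ta)).mul hpt ((lb.inv hpt).conj hpt hγt)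
    have e0 : a ^ p • R + a ^ p • R + -(b ^ p • R) = 0 := by
      rw [← add_smul, ← sub_eq_add_neg, ← sub_smul, hab', zero_smul]
    have gnew : SmoothGerm E fun t => ψ (a * t) * ψ (a * t) * (ψ (b * t))⁻¹ := (ga.mul ga).div gb
    have l2 : Lead (𝓝[≠] 0) (fun t => t ^ p)
        (fun t => ψ (a * t) * ψ (a * t) * (ψ (b * t))⁻¹ * (γ (t ^ k))⁻¹) (0 : E) := by
      rw [e0] at l1
      convert l1 using 1
      funext t
      have e1 : t ^ k = (a * t) ^ k + (a * t) ^ k - (b * t) ^ k := by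
        rw [mul_pow, mul_pow, ← add_mul, ← sub_mul, hab, one_mul]
      have e2 : γ (t ^ k) = γ ((a * t) ^ k) * γ ((a * t) ^ k) * (γ ((b * t) ^ k))⁻¹ := by
        rw [e1, hγ.map_sub, hγ.2.1]
      rw [e2]
      group
    obtain ⟨R', hR'⟩ := (gnew.div hγk).exists_lead_succ l2
    refine ⟨_, R', gnew, ?_, hR'⟩
    filter_upwards [eventually_comp k2 (smoothOn_const_mul a) (by simp),
      eventually_comp k2 (smoothOn_const_mul b) (by simp)] with t h1 h2
    exact H.mul_mem (H.mul_mem h1 h1) (H.inv_mem h2)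

end Approximation

/-! ### Products of many small factors: the normable case. -/

section Products

variable {E : Type*} [AddCommGroup E] [Module ℝ E] [TopologicalSpace E]
  [IsTopologicalAddGroup E] [ContinuousSMul ℝ E] [LocallyConvexSpace ℝ E] [T2Space E]
  {G : Type*} [TopologicalSpace G] [ChartedSpace E G] [Group G] [LieGroup E G]

variable (E G) in
/-- Products of `n` elements of size `O(n⁻ᴺ)` tend to the identity, where the order `N` may
depend on the neighbourhood of the identity considered. -/
def ProductsSmall : Prop :=
  ∀ U ∈ 𝓝 (1 : G), ∃ N : ℕ, ∃ V ∈ 𝓝 (0 : E), ∀ᶠ n : ℕ in atTop, ∀ d : ℕ → G,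
    (∀ j < n, d j ∈ (idChart E G).source ∧
      ((n : ℝ) ^ N) • (idChart E G (d j) - idPt E G) ∈ V) →
    ((List.range n).map d).prod ∈ U

theorem WithSeminorms.exists_ball_subset {p : Seminorm ℝ E}
    (hp : WithSeminorms fun _ : Unit => p) {x : E} {U : Set E} (hU : U ∈ 𝓝 x) :
    ∃ r > 0, ∀ y, p (y - x) < r → y ∈ U := by
  obtain ⟨s, r, hr, h⟩ := (hp.mem_nhds_iff x U).1 hU
  refine ⟨r, hr, fun y hy => h ?_⟩
  rw [Seminorm.mem_ball]
  refine lt_of_le_of_lt ?_ hy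
  exact (Finset.sup_le fun _ _ => le_rfl : s.sup (fun _ : Unit => p) ≤ p) _

/-- The exponent N = 1 works. By strict differentiability at (e, e), multiplying by a factor of size
O(1/n) moves a point near e by at most c/n in the single seminorm, so n factors move it by at most c
and never leave the region where the estimate holds. -/
theorem Normable.productsSmall (h : Normable E) : ProductsSmall E G := by
  intro U hU
  obtain ⟨p, hp⟩ := h
  have hUt : ∀ᶠ x in 𝓝 (idPt E G), (idChart E G).symm x ∈ U :=
    (tendsto_idChart_symm tendsto_id).eventually hU
  obtain ⟨r₀, hr₀, h₀⟩ := WithSeminorms.exists_ball_subset hp hUt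
  have lim := (smoothOn_mulC (E := E) (G := G)).tendsto isOpen_mulDom idPt_mem_mulDom
    (l := 𝓝 (idPt E G) ×ˢ (𝓝 (0 : E) ×ˢ 𝓝[≠] (0 : ℝ)))
    (x := fun q => (q.1, idPt E G)) (v := fun q => (0, q.2.1)) (s := fun q => q.2.2)
    (tendsto_fst.prodMk_nhds tendsto_const_nhds)
    (tendsto_const_nhds.prodMk_nhds (tendsto_fst.comp tendsto_snd))
    (tendsto_snd.comp tendsto_snd)
  have hdom : Tendsto (fun q : E × E × ℝ => (q.1, idPt E G + q.2.2 • q.2.1))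
      (𝓝 (idPt E G) ×ˢ (𝓝 (0 : E) ×ˢ 𝓝[≠] (0 : ℝ))) (𝓝 (idPt E G, idPt E G)) := by
    refine tendsto_fst.prodMk_nhds ?_
    have h1 : Tendsto (fun q : E × E × ℝ => q.2.2)
        (𝓝 (idPt E G) ×ˢ (𝓝 (0 : E) ×ˢ 𝓝[≠] (0 : ℝ))) (𝓝 0) :=
      tendsto_nhds_of_tendsto_nhdsWithin (tendsto_snd.comp tendsto_snd)
    simpa using (h1.smul (tendsto_fst.comp tendsto_snd)).const_add (idPt E G)
  have hball : {x : E | p x < 1} ∈ 𝓝 (0 : E) := by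
    refine (hp.mem_nhds_iff 0 _).2 ⟨{()}, 1, one_pos, fun x hx => ?_⟩
    simpa [Seminorm.mem_ball] using hx
  have e0 : dirDeriv (mulC E G) (idPt E G, idPt E G) ((0 : E), (0 : E)) = 0 :=
    SmoothOn.dirDeriv_zero
  rw [e0] at lim
  obtain ⟨A, hA, B, hB, hAB⟩ := mem_prod_iff.1
    ((lim.eventually hball).and (hdom.eventually (isOpen_mulDom.mem_nhds idPt_mem_mulDom)))
  obtain ⟨B₁, hB₁, B₂, hB₂, hB'⟩ := mem_prod_iff.1 hB
  obtain ⟨r₁, hr₁, h₁⟩ := WithSeminorms.exists_ball_subset hp hA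
  obtain ⟨r₂, hr₂, h₂⟩ := WithSeminorms.exists_ball_subset hp hB₁
  -- Being below r₁, c keeps every partial product where the increment estimate is valid; being
  -- below r₀, it puts the final product in U.
  set c := min r₀ r₁ / 2 with hc
  have hc0 : 0 < c := by have := lt_min hr₀ hr₁; positivity
  have hcr : c < r₀ ∧ c < r₁ := by
    have := lt_min hr₀ hr₁
    exact lt_min_iff.1 (by linarith)
  have hV : {x : E | p x < c * r₂} ∈ 𝓝 (0 : E) := by
    refine (hp.mem_nhds_iff 0 _).2 ⟨{()}, c * r₂, by positivity, fun x hx => ?_⟩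
    simpa [Seminorm.mem_ball] using hx
  refine ⟨1, _, hV, ?_⟩
  have hcn : Tendsto (fun n : ℕ => c / n) atTop (𝓝[≠] 0) := by
    refine tendsto_nhdsWithin_iff.2 ⟨tendsto_const_div_atTop_nhds_zero_nat c, ?_⟩
    filter_upwards [eventually_gt_atTop 0] with n hn
    have : (0 : ℝ) < n := by exact_mod_cast hn
    exact (div_pos hc0 this).ne'
  filter_upwards [hcn.eventually hB₂, eventually_gt_atTop 0] with n hn hn0 d hd
  have hn0' : (0 : ℝ) < n := by exact_mod_cast hn0
  have key : ∀ j ≤ n, ((List.range j).map d).prod ∈ (idChart E G).source ∧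
      p (idChart E G ((List.range j).map d).prod - idPt E G) ≤ j * (c / n) := by
    intro j
    induction j with
    | zero => intro _; simp
    | succ j ih =>
      intro hj
      obtain ⟨i1, i2⟩ := ih (by omega)
      obtain ⟨d1, d2⟩ := hd j (by omega)
      set w := ((List.range j).map d).prod with hw
      rw [List.range_succ, List.map_append, List.prod_append, ← hw]
      simp only [List.map_cons, List.map_nil, List.prod_cons, List.prod_nil, mul_one]
      have hjc : (j : ℝ) * (c / n) ≤ c := by
        have : (j : ℝ) ≤ n := by exact_mod_cast (by omega : j ≤ n)
        rw [mul_div_assoc', div_le_iff₀ hn0', mul_comm]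
        gcongr
      have m1 : idChart E G w ∈ A := h₁ _ (by linarith)
      -- The factor is written as e + (c/n)·v with v = (n/c)(κ(d j) - e) small, so that the
      -- difference quotient with step c/n has seminorm below 1.
      have m2 : (n / c : ℝ) • (idChart E G (d j) - idPt E G) ∈ B₁ := h₂ _ (by
        simp only [pow_one, map_smul_eq_mul, Real.norm_eq_abs,
          abs_of_pos hn0'] at d2
        rw [sub_zero, map_smul_eq_mul, Real.norm_eq_abs, abs_of_pos (div_pos hn0' hc0),
          div_mul_eq_mul_div, div_lt_iff₀ hc0]
        linarith)
      obtain ⟨k1, k2⟩ := hAB (mk_mem_prod m1 (hB' (mk_mem_prod m2 hn)))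
      have e1 : (c / n : ℝ) • (n / c : ℝ) • (idChart E G (d j) - idPt E G) =
          idChart E G (d j) - idPt E G := by
        rw [smul_smul, div_mul_div_comm, mul_comm c, div_self (by positivity), one_smul]
      simp only [Prod.smul_mk, Prod.mk_add_mk, smul_zero, add_zero, e1, add_sub_cancel,
        mulC_idChart i1 d1, mulC_idChart i1 (mem_chart_source E 1), mul_one,
        map_smul_eq_mul, Real.norm_eq_abs, abs_inv, abs_of_pos (div_pos hc0 hn0')] at k1
      have k2' : w * d j ∈ (idChart E G).source := by
        have := k2
        rw [e1, add_sub_cancel] at this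
        simpa [(idChart E G).left_inv i1, (idChart E G).left_inv d1] using this.2
      refine ⟨k2', ?_⟩
      rw [inv_mul_lt_iff₀ (div_pos hc0 hn0'), mul_one] at k1
      have := map_add_le_add p (idChart E G (w * d j) - idChart E G w)
        (idChart E G w - idPt E G)
      rw [sub_add_sub_cancel] at this
      push_cast
      linarith
  obtain ⟨k1, k2⟩ := key n le_rfl
  have : (n : ℝ) * (c / n) = c := by field_simp
  have : (idChart E G).symm (idChart E G ((List.range n).map d).prod) ∈ U :=
    h₀ _ (by linarith)
  rw [(idChart E G).left_inv k1] at this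
  exact this

end Products

/-! ### Stepwise constant paths, smoothed -/

/-- A smooth cutoff function, `0` on `(-∞, 1/3]` and `1` on `[2/3, ∞)`. -/
noncomputable def cutoff (s : ℝ) : ℝ := Real.smoothTransition (3 * s - 1)

theorem cutoff_of_le {s : ℝ} (h : s ≤ 1 / 3) : cutoff s = 0 :=
  Real.smoothTransition.zero_of_nonpos (by linarith)

theorem cutoff_of_ge {s : ℝ} (h : 2 / 3 ≤ s) : cutoff s = 1 :=
  Real.smoothTransition.one_of_one_le (by linarith)

theorem cutoff_mem (s : ℝ) : cutoff s ∈ Icc (0 : ℝ) 1 :=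
  ⟨Real.smoothTransition.nonneg _, Real.smoothTransition.le_one _⟩

theorem smoothOn_cutoff : SmoothOn cutoff univ :=
  smoothOn_of_contDiff fun _ => Real.smoothTransition.contDiff.comp
    ((contDiff_const.mul contDiff_id).sub contDiff_const)

section StepPath

variable {E : Type*} [AddCommGroup E] [Module ℝ E] [TopologicalSpace E]
  [IsTopologicalAddGroup E] [ContinuousSMul ℝ E] [LocallyConvexSpace ℝ E] [T2Space E]
  {G : Type*} [TopologicalSpace G] [ChartedSpace E G] [Group G] [LieGroup E G]

theorem SmoothCurveOn.of_local {φ : ℝ → G}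
    (h : ∀ t, ∃ O, IsOpen O ∧ t ∈ O ∧ SmoothCurveOn E φ O) : SmoothCurveOn E φ univ := by
  have hc : Continuous φ := continuous_iff_continuousAt.2 fun t =>
    let ⟨O, hO, ht, hφ⟩ := h t
    hφ.1.continuousAt (hO.mem_nhds ht)
  refine ⟨hc.continuousOn, fun e he => SmoothOn.of_local
    (isOpen_univ.inter (e.open_source.preimage hc)) fun t ht => ?_⟩
  obtain ⟨O, hO, hto, hφ⟩ := h t
  exact ⟨O ∩ φ ⁻¹' e.source, hO.inter (e.open_source.preimage hc), ⟨hto, ht.2⟩, hφ.2 e he⟩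

/-- The path through the points `w 0, w 1, …` at the times `0, 1 / n, 2 / n, …` which moves from
`w j` to `w (j + 1) = w j * κ⁻¹ (e + ζ j)` along the segment `[e, e + ζ j]` in the chart `κ`. -/
noncomputable def stepPath (n : ℕ) (w : ℕ → G) (ζ : ℕ → E) (t : ℝ) : G :=
  w ⌊n * t⌋₊ * (idChart E G).symm (idPt E G + cutoff (n * t - ⌊n * t⌋₊) • ζ ⌊n * t⌋₊)

/-- An open set containing `[j / n, (j + 1) / n]`. -/
def stepDom (n j : ℕ) : Set ℝ := {t | max (n * t) 0 - j ∈ Ioo (-(1 / 3) : ℝ) (4 / 3)}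

theorem isOpen_stepDom (n j : ℕ) : IsOpen (stepDom n j) :=
  isOpen_Ioo.preimage (by fun_prop : Continuous fun t : ℝ => max (n * t) 0 - j)

theorem mem_stepDom_floor (n : ℕ) (t : ℝ) : t ∈ stepDom n ⌊n * t⌋₊ := by
  have h : ⌊(n : ℝ) * t⌋₊ = ⌊max (n * t) 0⌋₊ := by
    rcases le_total ((n : ℝ) * t) 0 with h | h
    · rw [max_eq_right h, Nat.floor_of_nonpos h, Nat.floor_zero]
    · rw [max_eq_left h]
  have h1 := Nat.floor_le (le_max_right ((n : ℝ) * t) 0)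
  have h2 := Nat.lt_floor_add_one (max ((n : ℝ) * t) 0)
  rw [← h] at h1 h2
  constructor <;> linarith

/-- Each stepwise formula persists a third of a step beyond its interval: there one cutoff has
already reached 1 and the next is still 0, so neighbouring formulas agree. The maximum in `stepDom`
puts all negative times, where the path is constant, into the first domain. -/
theorem stepPath_eq {n : ℕ} {w : ℕ → G} {ζ : ℕ → E}
    (hw : ∀ j, w (j + 1) = w j * (idChart E G).symm (idPt E G + ζ j)) {j : ℕ} {t : ℝ}
    (ht : t ∈ stepDom n j) :
    stepPath n w ζ t = w j * (idChart E G).symm (idPt E G + cutoff (n * t - j) • ζ j) := by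
  have h3 := mem_stepDom_floor n t
  unfold stepPath
  rw [stepDom, Set.mem_ofPred_eq, mem_Ioo] at ht h3
  have hne : ∀ i : ℕ, 0 < i → (-(1 / 3) : ℝ) < max (n * t) 0 - i → max ((n : ℝ) * t) 0 = n * t :=
    fun i hi h => by
      have : (1 : ℝ) ≤ i := by exact_mod_cast hi
      rcases max_choice ((n : ℝ) * t) 0 with h' | h'
      · exact h'
      · rw [h'] at h; linarith
  generalize hi : ⌊(n : ℝ) * t⌋₊ = i at h3 ⊢
  rcases lt_trichotomy i j with hij | rfl | hij
  · have hji : j = i + 1 := by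
      have : (j : ℝ) < i + 2 := by linarith
      have : j < i + 2 := by exact_mod_cast this
      omega
    subst hji
    have e := hne _ (by omega) ht.1
    have h5 := Nat.lt_floor_add_one ((n : ℝ) * t)
    rw [hi] at h5
    rw [e] at ht
    push_cast at ht ⊢
    rw [cutoff_of_ge (by linarith), cutoff_of_le (by linarith), hw]
    simp
  · rfl
  · have hji : i = j + 1 := by
      have : (i : ℝ) < j + 2 := by linarith
      have : i < j + 2 := by exact_mod_cast this
      omega
    subst hji
    have e := hne _ (by omega) h3.1
    have h5 : (⌊(n : ℝ) * t⌋₊ : ℝ) ≤ n * t := Nat.floor_le (by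
      rw [e] at h3
      have : (0 : ℝ) ≤ j := by positivity
      push_cast at h3
      linarith)
    rw [hi] at h5
    rw [e] at ht
    push_cast at h5 ⊢
    rw [cutoff_of_ge (s := n * t - j) (by linarith), cutoff_of_le (by linarith), hw]
    simp

/-- The left division of two points of the segment `[e, e + ζ]`, read in the chart. -/
noncomputable def segDiv (E G : Type*) [AddCommGroup E] [Module ℝ E] [TopologicalSpace E]
    [TopologicalSpace G] [ChartedSpace E G] [Group G] (q : E × ℝ × ℝ) : E :=
  mulC E G (invC E G (idPt E G + cutoff q.2.1 • q.1), idPt E G + cutoff q.2.2 • q.1)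

/-- The domain of the left division in the chart. -/
def ldivDom (E G : Type*) [TopologicalSpace E] [TopologicalSpace G] [ChartedSpace E G] [Group G] :
    Set (E × E) :=
  (invDom E G ×ˢ (idChart E G).target) ∩ (fun p => (invC E G p.1, p.2)) ⁻¹' mulDom E G

theorem smoothOn_invC_prod :
    SmoothOn (fun p : E × E => (invC E G p.1, p.2)) (invDom E G ×ˢ (idChart E G).target) :=
  (smoothOn_invC.comp (smoothOn_clm (ContinuousLinearMap.fst ℝ E E) _) isOpen_invDom
      (fun _ hp => hp.1) (isOpen_invDom.prod (idChart E G).open_target)).prodMk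
    (smoothOn_clm (ContinuousLinearMap.snd ℝ E E) _)

theorem isOpen_ldivDom : IsOpen (ldivDom E G) :=
  (smoothOn_invC_prod (E := E) (G := G)).continuousOn.isOpen_inter_preimage
    (isOpen_invDom.prod (idChart E G).open_target) isOpen_mulDom

theorem idPt_mem_ldivDom : (idPt E G, idPt E G) ∈ ldivDom E G := by
  refine ⟨⟨mem_invDom (mem_chart_source E 1) (by simp), idPt_mem_target⟩, ?_⟩
  rw [mem_preimage, invC_idChart (mem_chart_source E 1), inv_one]
  exact idPt_mem_mulDom

/-- The domain of `segDiv`. -/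
def segDom (E G : Type*) [AddCommGroup E] [Module ℝ E] [TopologicalSpace E]
    [TopologicalSpace G] [ChartedSpace E G] [Group G] : Set (E × ℝ × ℝ) :=
  (fun q => (idPt E G + cutoff q.2.1 • q.1, idPt E G + cutoff q.2.2 • q.1)) ⁻¹' ldivDom E G

theorem smoothOn_seg : SmoothOn (fun q : E × ℝ × ℝ =>
    (idPt E G + cutoff q.2.1 • q.1, idPt E G + cutoff q.2.2 • q.1)) univ := by
  have h1 : SmoothOn (fun q : E × ℝ × ℝ => q.1) univ :=
    smoothOn_clm (ContinuousLinearMap.fst ℝ E (ℝ × ℝ)) _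
  have h2 : SmoothOn (fun q : E × ℝ × ℝ => cutoff q.2.1) univ :=
    smoothOn_cutoff.comp (smoothOn_clm ((ContinuousLinearMap.fst ℝ ℝ ℝ).comp
      (ContinuousLinearMap.snd ℝ E (ℝ × ℝ))) _) isOpen_univ (fun _ _ => trivial) isOpen_univ
  have h3 : SmoothOn (fun q : E × ℝ × ℝ => cutoff q.2.2) univ :=
    smoothOn_cutoff.comp (smoothOn_clm ((ContinuousLinearMap.snd ℝ ℝ ℝ).comp
      (ContinuousLinearMap.snd ℝ E (ℝ × ℝ))) _) isOpen_univ (fun _ _ => trivial) isOpen_univ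
  exact ((smoothOn_const _ _).add (h2.smul h1 isOpen_univ) isOpen_univ).prodMk
    ((smoothOn_const _ _).add (h3.smul h1 isOpen_univ) isOpen_univ)

theorem isOpen_segDom : IsOpen (segDom E G) := by
  have := (smoothOn_seg (E := E) (G := G)).continuousOn.isOpen_inter_preimage isOpen_univ
    (isOpen_ldivDom (E := E) (G := G))
  rwa [univ_inter] at this

theorem smoothOn_segDiv : SmoothOn (segDiv E G) (segDom E G) :=
  SmoothOn.comp (f := fun p : E × E => mulC E G (invC E G p.1, p.2)) (V := ldivDom E G)
    (smoothOn_mulC.comp (smoothOn_invC_prod.mono inter_subset_left) isOpen_mulDom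
      (fun _ hp => hp.2) isOpen_ldivDom)
    (smoothOn_seg.mono (subset_univ _)) isOpen_ldivDom (fun _ h => h) isOpen_segDom

/-- The times range over all of ℝ, but enter only through cutoff values in the compact interval [0,
1]. -/
theorem eventually_mem_segDom : ∀ᶠ ζ in 𝓝 (0 : E), ∀ s s' : ℝ, (ζ, s, s') ∈ segDom E G := by
  have key : ∀ᶠ ζ in 𝓝 (0 : E), ∀ c ∈ Icc (0 : ℝ) 1 ×ˢ Icc (0 : ℝ) 1,
      (idPt E G + c.1 • ζ, idPt E G + c.2 • ζ) ∈ ldivDom E G := by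
    refine (isCompact_Icc.prod isCompact_Icc).eventually_forall_of_forall_eventually
      fun c _ => ?_
    have h : Continuous fun z : E × ℝ × ℝ =>
      (idPt E G + z.2.1 • z.1, idPt E G + z.2.2 • z.1) := by fun_prop
    have h' := h.tendsto (0, c)
    simp only [smul_zero, add_zero] at h'
    exact h'.eventually (isOpen_ldivDom.mem_nhds idPt_mem_ldivDom)
  exact key.mono fun ζ h s s' => h (cutoff s, cutoff s') ⟨cutoff_mem s, cutoff_mem s'⟩

/-- The domain of `segVel`. -/
def segVelDom (E G : Type*) [AddCommGroup E] [Module ℝ E] [TopologicalSpace E]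
    [TopologicalSpace G] [ChartedSpace E G] [Group G] : Set (E × ℝ) :=
  (fun q => (q.1, q.2, q.2)) ⁻¹' segDom E G

theorem isOpen_segVelDom : IsOpen (segVelDom E G) :=
  isOpen_segDom.preimage (by fun_prop)

/-- The `i`-th derivative in `s` of the left logarithmic derivative of the path
`s ↦ κ⁻¹ (e + cutoff s • ζ)`. -/
noncomputable def segVel (E G : Type*) [AddCommGroup E] [Module ℝ E] [TopologicalSpace E]
    [TopologicalSpace G] [ChartedSpace E G] [Group G] : ℕ → E × ℝ → E
  | 0, q => dirDeriv (segDiv E G) (q.1, q.2, q.2) (0, 0, 1)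
  | i + 1, q => dirDeriv (segVel E G i) q (0, 1)

theorem smoothOn_segVel (i : ℕ) : SmoothOn (segVel E G i) (segVelDom E G) := by
  induction i with
  | zero =>
    exact (smoothOn_segDiv.dirDeriv isOpen_segDom (0, 0, 1)).comp
      ((smoothOn_clm (ContinuousLinearMap.fst ℝ E ℝ) _).prodMk
        ((smoothOn_clm (ContinuousLinearMap.snd ℝ E ℝ) _).prodMk
          (smoothOn_clm (ContinuousLinearMap.snd ℝ E ℝ) _))) isOpen_segDom (fun _ h => h)
      isOpen_segVelDom
  | succ i ih => exact ih.dirDeriv isOpen_segVelDom (0, 1)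

theorem segVel_zero (i : ℕ) (s : ℝ) : segVel E G i (0, s) = 0 := by
  induction i generalizing s with
  | zero =>
    refine HasDirDeriv.dirDeriv_eq ?_
    simp [HasDirDeriv, segDiv]
  | succ i ih =>
    refine HasDirDeriv.dirDeriv_eq ?_
    simp [HasDirDeriv, ih]

theorem zero_mem_segVelDom (s : ℝ) : ((0 : E), s) ∈ segVelDom E G := by
  simpa [segVelDom, segDom] using idPt_mem_ldivDom

/-- Since `segVel` vanishes at ζ = 0, the expression is a difference quotient in a direction tending
to 0, hence tends to 0. Compactness gives uniformity in s. -/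
theorem eventually_segVel_mem (i : ℕ) {V : Set E} (hV : V ∈ 𝓝 0) :
    ∀ᶠ q : E × ℝ in 𝓝 0, ∀ s ∈ Icc (0 : ℝ) 1, q.2 ≠ 0 →
      q.2⁻¹ • segVel E G i (q.2 • q.1, s) ∈ V := by
  refine isCompact_Icc.eventually_forall_of_forall_eventually fun s _ => ?_
  have lim := (smoothOn_segVel (E := E) (G := G) i).tendsto isOpen_segVelDom
    (l := 𝓝 ((0 : E × ℝ), s) ⊓ 𝓟 {z | z.1.2 ≠ 0})
    (x := fun z => (0, z.2)) (v := fun z => (z.1.1, 0)) (s := fun z => z.1.2) (v₀ := (0, 0))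
    (zero_mem_segVelDom s)
    (tendsto_const_nhds.prodMk_nhds ((continuous_snd.tendsto _).mono_left inf_le_left))
    ((((continuous_fst.comp continuous_fst).tendsto ((0 : E × ℝ), s)).mono_left
      inf_le_left).prodMk_nhds tendsto_const_nhds)
    (tendsto_nhdsWithin_iff.2 ⟨((continuous_snd.comp continuous_fst).tendsto
      ((0 : E × ℝ), s)).mono_left inf_le_left, mem_inf_of_right (mem_principal_self _)⟩)
  have e0 : dirDeriv (segVel E G i) (0, s) ((0 : E), (0 : ℝ)) = 0 := SmoothOn.dirDeriv_zero
  rw [e0] at lim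
  filter_upwards [eventually_inf_principal.1 (lim.eventually hV)] with z hz hz0
  have := hz hz0
  simp only [Prod.smul_mk, Prod.mk_add_mk, smul_zero, add_zero, zero_add, segVel_zero,
    sub_zero] at this
  exact this

omit [IsTopologicalAddGroup E] [ContinuousSMul ℝ E] [LocallyConvexSpace ℝ E] [T2Space E] in
theorem segDiv_eq {ζ : E} {s : ℝ} (h : (ζ, s, s) ∈ segDom E G) (s' : ℝ) :
    segDiv E G (ζ, s, s') = idChart E G (((idChart E G).symm (idPt E G + cutoff s • ζ))⁻¹ *
      (idChart E G).symm (idPt E G + cutoff s' • ζ)) := by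
  have h1 : ((idChart E G).symm (idPt E G + cutoff s • ζ))⁻¹ ∈ (idChart E G).source := h.1.1.2
  simp only [segDiv, mulC, invC, (idChart E G).left_inv h1]

theorem HasDirDeriv.comp_affine {c : ℝ → E} {a b t : ℝ} {v : E}
    (h : HasDirDeriv c (a * t - b) 1 v) : HasDirDeriv (fun s => c (a * s - b)) t 1 (a • v) := by
  refine Tendsto.congr (fun τ => ?_) (h.smul_dir a)
  have : a * t - b + τ • a • (1 : ℝ) = a * (t + τ • 1) - b := by
    simp only [smul_eq_mul]; ring
  rw [this]

/-- The left factor w cancels in the logarithmic derivative, and each differentiation of the time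
change t ↦ nt - j contributes a factor n. The logarithmic derivative itself accounts for the first.
-/
theorem iterate_curveDeriv_leftLogDeriv {n j : ℕ} {w : G} {ζ : E} {η : ℝ → G} {O : Set ℝ}
    (hO : IsOpen O)
    (hη : ∀ t ∈ O, η t = w * (idChart E G).symm (idPt E G + cutoff (n * t - j) • ζ))
    (hζ : ∀ s s' : ℝ, (ζ, s, s') ∈ segDom E G) (i : ℕ) {t : ℝ} (ht : t ∈ O) :
    curveDeriv^[i] (leftLogDeriv E η) t = ((n : ℝ) ^ (i + 1)) • segVel E G i (ζ, n * t - j) := by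
  induction i generalizing t with
  | zero =>
    simp only [Function.iterate_zero, id, zero_add, pow_one, leftLogDeriv]
    have h1 : dirDeriv (fun s => idChart E G ((η t)⁻¹ * η s)) t 1 =
        dirDeriv (fun s => segDiv E G (ζ, n * t - j, n * s - j)) t 1 := by
      refine dirDeriv_congr ?_ 1
      filter_upwards [hO.mem_nhds ht] with s hs
      rw [hη t ht, hη s hs, segDiv_eq (hζ _ _)]
      congr 1
      group
    rw [h1]
    refine HasDirDeriv.dirDeriv_eq (HasDirDeriv.comp_affine
      (c := fun s' => segDiv E G (ζ, n * t - j, s')) ?_)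
    refine Tendsto.congr (fun τ => ?_) ((smoothOn_segDiv (E := E) (G := G)).hasDirDeriv
      isOpen_segDom (hζ (n * t - j) (n * t - j)) (0, 0, 1))
    simp
  | succ i ih =>
    rw [Function.iterate_succ_apply']
    rw [eqOn_curveDeriv hO (fun s hs => ih hs) ht]
    have h1 : HasDirDeriv (fun s => segVel E G i (ζ, s)) (n * t - j) 1
        (segVel E G (i + 1) (ζ, n * t - j)) := by
      refine Tendsto.congr (fun τ => ?_) ((smoothOn_segVel (E := E) (G := G) i).hasDirDeriv
        isOpen_segVelDom (x := (ζ, n * t - j)) (hζ _ _) (0, 1))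
      simp
    have h2 := (h1.comp_affine (a := n)).const_smul ((n : ℝ) ^ (i + 1))
    rw [pow_succ (n : ℝ) (i + 1), mul_smul]
    refine HasDirDeriv.dirDeriv_eq (h2.congr fun τ => ?_)
    rw [← smul_sub, smul_comm]

/-- The product is the endpoint of the step path. Up to order m the derivatives of its logarithmic
derivative carry factors at most n^(m+1), so increments of size O(n^-(m+1)) keep them small. -/
theorem ContinuousEvolution.productsSmall (h : ContinuousEvolution E G) : ProductsSmall E G := by
  intro U hU
  obtain ⟨m, V, hV, hVU⟩ := h U hU
  obtain ⟨W, ⟨hW, hWb⟩, hWV⟩ := (nhds_basis_balanced ℝ E).mem_iff.1 hV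
  have ev : ∀ᶠ q : E × ℝ in 𝓝 0, (∀ i ∈ Iic m, ∀ s ∈ Icc (0 : ℝ) 1, q.2 ≠ 0 →
      q.2⁻¹ • segVel E G i (q.2 • q.1, s) ∈ W) ∧
      ∀ s s' : ℝ, (q.2 • q.1, s, s') ∈ segDom E G := by
    refine ((eventually_all_finite (finite_Iic m)).2 fun i _ => eventually_segVel_mem i hW).and ?_
    have : Continuous fun q : E × ℝ => q.2 • q.1 := by fun_prop
    have h0 := this.tendsto 0
    simp only [Prod.snd_zero, zero_smul] at h0
    exact h0.eventually eventually_mem_segDom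
  rw [show (0 : E × ℝ) = ((0 : E), (0 : ℝ)) from rfl, nhds_prod_eq] at ev
  obtain ⟨A, hA, B, hB, hAB⟩ := mem_prod_iff.1 ev
  refine ⟨m + 1, A, hA, ?_⟩
  have hlim : Tendsto (fun n : ℕ => ((n : ℝ) ^ (m + 1))⁻¹) atTop (𝓝 0) :=
    tendsto_inv_atTop_zero.comp ((tendsto_pow_atTop (by omega)).comp tendsto_natCast_atTop_atTop)
  filter_upwards [hlim.eventually hB, eventually_gt_atTop 0] with n hn hn0 d hd
  have hn0' : (0 : ℝ) < n := by exact_mod_cast hn0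
  have hn1 : (1 : ℝ) ≤ n := by exact_mod_cast hn0
  -- Padding with 1 makes the path defined, and smooth, for all times, beyond t = 1 as well.
  set d' : ℕ → G := fun j => if j < n then d j else 1 with hd'
  set ζ : ℕ → E := fun j => idChart E G (d' j) - idPt E G with hζ
  set w : ℕ → G := fun j => ((List.range j).map d').prod with hw
  have hd's : ∀ j, d' j ∈ (idChart E G).source ∧ ((n : ℝ) ^ (m + 1)) • ζ j ∈ A := fun j => by
    by_cases hj : j < n
    · simpa only [hζ, hd', if_pos hj] using hd j hj
    · simpa only [hζ, hd', if_neg hj, sub_self, smul_zero] using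
        ⟨mem_chart_source E (1 : G), mem_of_mem_nhds hA⟩
  have hw1 : ∀ j, w (j + 1) = w j * (idChart E G).symm (idPt E G + ζ j) := fun j => by
    simp only [hw, hζ, add_sub_cancel, (idChart E G).left_inv (hd's j).1, List.range_succ,
      List.map_append, List.prod_append, List.map_cons, List.map_nil, List.prod_cons,
      List.prod_nil, mul_one]
  have hAB' : ∀ j, (∀ i ∈ Iic m, ∀ s ∈ Icc (0 : ℝ) 1,
      ((n : ℝ) ^ (m + 1)) • segVel E G i (ζ j, s) ∈ W) ∧
      ∀ s s' : ℝ, (ζ j, s, s') ∈ segDom E G := fun j => by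
    obtain ⟨h1, h2⟩ := hAB (mk_mem_prod (hd's j).2 hn)
    have hp : ((n : ℝ) ^ (m + 1)) ≠ 0 := by positivity
    simp only [inv_smul_smul₀ hp, inv_inv] at h1 h2
    exact ⟨fun i hi s hs => h1 i hi s hs (inv_ne_zero hp), h2⟩
  have hη := fun (j : ℕ) (t : ℝ) (ht : t ∈ stepDom n j) => stepPath_eq hw1 ht
  have hend : ((List.range n).map d).prod = stepPath n w ζ 1 := by
    have e : w n = ((List.range n).map d).prod := by
      simp only [hw]
      congr 1
      exact List.map_congr_left fun j hj => if_pos (List.mem_range.1 hj)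
    simp [stepPath, cutoff_of_le, e]
  rw [hend]
  refine hVU _ (SmoothCurveOn.of_local fun t => ?_) ?_ fun i hi t ht => hWV ?_
  · refine ⟨_, isOpen_stepDom n _, mem_stepDom_floor n t,
      smoothCurveOn_of_chart (w ⌊n * t⌋₊) (isOpen_stepDom n _)
      (c := fun t' => idPt E G + cutoff (n * t' - ⌊n * t⌋₊) • ζ ⌊n * t⌋₊) ?_ ?_ (hη _)⟩
    · refine ((smoothOn_const _ univ).add (SmoothOn.smul (smoothOn_cutoff.comp
        (smoothOn_of_contDiff fun _ => ?_) isOpen_univ (fun _ _ => trivial) isOpen_univ)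
        (smoothOn_const _ univ) isOpen_univ) isOpen_univ).mono (subset_univ _)
      exact (contDiff_const.mul contDiff_id).sub contDiff_const
    · exact fun t' _ => ((hAB' ⌊n * t⌋₊).2 0 (n * t' - ⌊n * t⌋₊)).1.2
  · simp [stepPath, cutoff_of_le, hw]
  · rw [iterate_curveDeriv_leftLogDeriv (isOpen_stepDom n _) (hη _) (hAB' _).2 i
      (mem_stepDom_floor n t)]
    have hnt : 0 ≤ (n : ℝ) * t := mul_nonneg hn0'.le ht.1
    have h1 := Nat.floor_le hnt
    have h2 := Nat.lt_floor_add_one ((n : ℝ) * t)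
    have h3 := (hAB' ⌊n * t⌋₊).1 i hi (n * t - ⌊n * t⌋₊) ⟨by linarith, by linarith⟩
    -- For i ≤ m the ratio n^(i+1)/n^(m+1) is at most 1, so the balanced neighbourhood W absorbs it.
    have e : (n : ℝ) ^ (i + 1) = (n : ℝ) ^ (i + 1) / n ^ (m + 1) * n ^ (m + 1) := by
      field_simp
    rw [e, mul_smul]
    refine hWb.smul_mem ?_ h3
    rw [Real.norm_eq_abs, abs_of_nonneg (by positivity)]
    exact div_le_one_of_le₀ (pow_le_pow_right₀ hn1 (by simpa using hi)) (by positivity)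

end StepPath

/-! ### Conjugated errors and the exponential image in the closure. -/

section Exponential

variable {E : Type*} [AddCommGroup E] [Module ℝ E] [TopologicalSpace E]
  [IsTopologicalAddGroup E] [ContinuousSMul ℝ E] [LocallyConvexSpace ℝ E] [T2Space E]
  {G : Type*} [TopologicalSpace G] [ChartedSpace E G] [Group G] [LieGroup E G]

variable (E G) in
/-- The conjugation `(g, h) ↦ g h g⁻¹`, read in the chart at the identity. -/
noncomputable def conjC (p : E × E) : E := divC E G (mulC E G p, p.1)

variable (E G) in
/-- The domain of `conjC`. -/
def conjDom : Set (E × E) := mulDom E G ∩ (fun p => (mulC E G p, p.1)) ⁻¹' divDom E G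

theorem smoothOn_mulC_fst :
    SmoothOn (fun p : E × E => (mulC E G p, p.1)) (mulDom E G) :=
  smoothOn_mulC.prodMk (smoothOn_clm (ContinuousLinearMap.fst ℝ E E) _)

theorem isOpen_conjDom : IsOpen (conjDom E G) :=
  (smoothOn_mulC_fst (E := E) (G := G)).continuousOn.isOpen_inter_preimage isOpen_mulDom
    isOpen_divDom

theorem smoothOn_conjC : SmoothOn (conjC E G) (conjDom E G) :=
  smoothOn_divC.comp (smoothOn_mulC_fst.mono inter_subset_left) isOpen_divDom
    (fun _ hp => hp.2) isOpen_conjDom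

theorem mem_conjDom_idPt {g : G} (hg : g ∈ (idChart E G).source)
    (hg' : g⁻¹ ∈ (idChart E G).source) : (idChart E G g, idPt E G) ∈ conjDom E G := by
  have h1 : (1 : G) ∈ (idChart E G).source := mem_chart_source E 1
  refine ⟨mem_mulDom hg h1 (by simpa using hg), ?_⟩
  rw [mem_preimage, mulC_idChart hg h1, mul_one]
  exact mem_divDom hg hg hg' (by simp)

theorem conjC_idChart {g h : G} (hg : g ∈ (idChart E G).source) (hh : h ∈ (idChart E G).source)
    (hd : (idChart E G g, idChart E G h) ∈ conjDom E G) :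
    g * h * g⁻¹ ∈ (idChart E G).source ∧
      conjC E G (idChart E G g, idChart E G h) = idChart E G (g * h * g⁻¹) := by
  have h1 : g * h ∈ (idChart E G).source := by
    simpa [(idChart E G).left_inv hg, (idChart E G).left_inv hh] using hd.1.2
  have hd2 := hd.2
  rw [mem_preimage, mulC_idChart hg hh] at hd2
  have h2 : g⁻¹ ∈ (idChart E G).source := by
    simpa [(idChart E G).left_inv hg] using hd2.1.2.2
  have h3 := hd2.2
  rw [mem_preimage] at h3
  refine ⟨?_, by rw [conjC, mulC_idChart hg hh, divC_idChart h1 hg h2]⟩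
  have h4 := h3.2
  simpa [invC_idChart hg, (idChart E G).left_inv h1, (idChart E G).left_inv h2] using h4

/-- Conjugation fixes 1, so conjugating e + h x with x tending to 0 leaves a coordinate error that
is o(h). Compactness of [0, σ] makes this uniform in the conjugating element γ(θ). -/
theorem eventually_conj_mem {γ : ℝ → G} (hγ : Continuous γ) {σ : ℝ}
    (hσ : ∀ θ ∈ Icc 0 σ, γ θ ∈ (idChart E G).source ∧ (γ θ)⁻¹ ∈ (idChart E G).source)
    {V : Set E} (hV : V ∈ 𝓝 0) :
    ∀ᶠ q : E × ℝ in 𝓝 0, ∀ θ ∈ Icc 0 σ, q.2 ≠ 0 → ∀ g ∈ (idChart E G).source,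
      idChart E G g = idPt E G + q.2 • q.1 →
      γ θ * g * (γ θ)⁻¹ ∈ (idChart E G).source ∧
        q.2⁻¹ • (idChart E G (γ θ * g * (γ θ)⁻¹) - idPt E G) ∈ V := by
  refine isCompact_Icc.eventually_forall_of_forall_eventually fun θ hθ => ?_
  obtain ⟨s1, s2⟩ := hσ θ hθ
  have hd := mem_conjDom_idPt s1 s2
  have tγ : Tendsto (fun z : (E × ℝ) × ℝ => γ z.2) (𝓝 ((0 : E × ℝ), θ)) (𝓝 (γ θ)) :=
    (hγ.comp continuous_snd).tendsto ((0 : E × ℝ), θ)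
  have tκ : Tendsto (fun z : (E × ℝ) × ℝ => idChart E G (γ z.2)) (𝓝 ((0 : E × ℝ), θ))
      (𝓝 (idChart E G (γ θ))) := ((idChart E G).continuousAt s1).tendsto.comp tγ
  have lim := (smoothOn_conjC (E := E) (G := G)).tendsto isOpen_conjDom
    (l := 𝓝 ((0 : E × ℝ), θ) ⊓ 𝓟 {z | z.1.2 ≠ 0})
    (x := fun z => (idChart E G (γ z.2), idPt E G)) (v := fun z => (0, z.1.1))
    (s := fun z => z.1.2) (v₀ := (0, 0)) hd
    ((tκ.mono_left inf_le_left).prodMk_nhds tendsto_const_nhds)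
    (tendsto_const_nhds.prodMk_nhds
      (((continuous_fst.comp continuous_fst).tendsto ((0 : E × ℝ), θ)).mono_left inf_le_left))
    (tendsto_nhdsWithin_iff.2 ⟨((continuous_snd.comp continuous_fst).tendsto
      ((0 : E × ℝ), θ)).mono_left inf_le_left, mem_inf_of_right (mem_principal_self _)⟩)
  have e0 : dirDeriv (conjC E G) (idChart E G (γ θ), idPt E G) ((0 : E), (0 : E)) = 0 :=
    SmoothOn.dirDeriv_zero
  rw [e0] at lim
  have tx : Tendsto (fun z : (E × ℝ) × ℝ => idPt E G + z.1.2 • z.1.1) (𝓝 ((0 : E × ℝ), θ))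
      (𝓝 (idPt E G)) := by
    have : Continuous fun z : (E × ℝ) × ℝ => idPt E G + z.1.2 • z.1.1 := by fun_prop
    simpa using this.tendsto ((0 : E × ℝ), θ)
  filter_upwards [eventually_inf_principal.1 (lim.eventually hV),
    (tκ.prodMk_nhds tx).eventually (isOpen_conjDom.mem_nhds hd),
    (tκ.prodMk_nhds tendsto_const_nhds).eventually (isOpen_conjDom.mem_nhds hd),
    tγ.eventually ((idChart E G).open_source.mem_nhds s1)] with z z1 z2 z3 z4 hz g hg hgz
  have z1 := z1 hz
  rw [← hgz] at z2
  obtain ⟨c1, c2⟩ := conjC_idChart z4 hg z2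
  obtain ⟨-, c3⟩ := conjC_idChart z4 (mem_chart_source E 1) z3
  simp only [Prod.smul_mk, Prod.mk_add_mk, smul_zero, add_zero, ← hgz, c2, c3, mul_one,
    mul_inv_cancel] at z1
  exact ⟨c1, z1⟩

variable {γ : ℝ → G} {X : E} {H : Subgroup G}

/-- Telescoping: the global error g^n γ(nτ)⁻¹ is a product of conjugates of the local error g
γ(τ)⁻¹. -/
theorem IsOneParameterSubgroup.prod_conj (hγ : IsOneParameterSubgroup γ X) (g : G) (τ : ℝ)
    (n : ℕ) : ((List.range n).map fun j : ℕ =>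
      γ (j * τ) * (g * (γ τ)⁻¹) * (γ (j * τ))⁻¹).prod = g ^ n * (γ (n * τ))⁻¹ := by
  induction n with
  | zero => simp [hγ.map_zero]
  | succ n ih =>
    rw [List.range_succ, List.map_append, List.prod_append, ih]
    simp only [List.map_cons, List.map_nil, List.prod_cons, List.prod_nil, mul_one]
    rw [Nat.cast_succ, add_mul, one_mul, hγ.2.1, pow_succ]
    group

/-- For τ^k = σ/n, the powers ψ(τ)^n lie in H for large n, and ψ(τ)^n γ(σ)⁻¹ is a product of n
conjugated local errors, hence close to 1. -/
theorem ProductsSmall.mem_closure (hP : ProductsSmall E G) (hX : IsLeadingIn H X)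
    (hγ : IsOneParameterSubgroup γ X) {σ : ℝ} (hσ0 : 0 < σ)
    (hσ : ∀ θ ∈ Icc 0 σ, γ θ ∈ (idChart E G).source ∧ (γ θ)⁻¹ ∈ (idChart E G).source) :
    γ σ ∈ closure (H : Set G) := by
  have := isTopologicalGroup E G
  rw [mem_closure_iff_nhds]
  intro W hW
  have hU : {u : G | u * γ σ ∈ W} ∈ 𝓝 (1 : G) := by
    have h : Continuous fun u : G => u * γ σ := by fun_prop
    exact h.continuousAt (by simpa using hW)
  obtain ⟨N, V, hV, hn⟩ := hP _ hU
  obtain ⟨V', ⟨hV', hVb⟩, hVV⟩ := (nhds_basis_balanced ℝ E).mem_iff.1 hV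
  obtain ⟨k, hk, hap⟩ := hX.exists_approx hγ
  -- Order k(N+1)+1 gives τ^p = (σ/n)^(N+1) τ, so the error remains o(1) after multiplication by
  -- n^(N+1). The exponent N + 1 is used because the step n^-(N+1) tends to 0 even for N = 0.
  obtain ⟨ψ, R, h1, h2, h3⟩ := hap (k * (N + 1) + 1) (by
    have : k * 1 ≤ k * (N + 1) := Nat.mul_le_mul_left k (by omega)
    omega)
  set τ : ℕ → ℝ := fun n => (σ / n) ^ (k⁻¹ : ℝ) with hτ
  have hτk : ∀ n, τ n ^ k = σ / n := fun n =>
    Real.rpow_inv_natCast_pow (by positivity) (by omega)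
  have hτ0 : Tendsto τ atTop (𝓝[≠] 0) := by
    refine tendsto_nhdsWithin_iff.2 ⟨?_, ?_⟩
    · have hk0 : (0 : ℝ) < (k : ℝ)⁻¹ := inv_pos.2 (by exact_mod_cast hk)
      have := (tendsto_const_div_atTop_nhds_zero_nat σ).rpow_const (Or.inr hk0.le)
      rwa [Real.zero_rpow hk0.ne'] at this
    · filter_upwards [eventually_gt_atTop 0] with n hn
      have : (0 : ℝ) < n := by exact_mod_cast hn
      exact (Real.rpow_pos_of_pos (div_pos hσ0 this) _).ne'
  have hτ0' := tendsto_nhdsWithin_iff.1 hτ0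
  have l1 := h3.comp hτ0
  set ε : ℕ → G := fun n => ψ (τ n) * (γ (σ / n))⁻¹ with hε
  have hε' : (fun n => ψ (τ n) * (γ (τ n ^ k))⁻¹) = ε := by simp only [hε, hτk]
  rw [hε'] at l1
  have tz : Tendsto (fun n : ℕ => ((n : ℝ) ^ (N + 1)) • (idChart E G (ε n) - idPt E G)) atTop
      (𝓝 0) := by
    have h4 : Tendsto (fun n => σ ^ (N + 1) * τ n) atTop (𝓝 0) := by
      simpa using hτ0'.1.const_mul (σ ^ (N + 1))
    have h5 := h4.smul l1.tendsto_quot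
    rw [zero_smul] at h5
    refine h5.congr' ?_
    filter_upwards [hτ0'.2, eventually_gt_atTop 0] with n hn hn0
    have hn : τ n ≠ 0 := hn
    have hn0 : (n : ℝ) ≠ 0 := by exact_mod_cast hn0.ne'
    rw [smul_smul]
    congr 1
    rw [pow_succ (τ n), pow_mul, hτk, div_pow]
    field_simp
  have th : Tendsto (fun n : ℕ => ((n : ℝ) ^ (N + 1))⁻¹) atTop (𝓝 0) :=
    tendsto_inv_atTop_zero.comp ((tendsto_pow_atTop (by omega)).comp tendsto_natCast_atTop_atTop)
  have ev := (tz.prodMk_nhds th).eventually (eventually_conj_mem hγ.continuous hσ hV')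
  obtain ⟨n, n1, n2, n3, n4, n5⟩ := (hn.and (ev.and ((eventually_gt_atTop 0).and
    ((eventually_mem_source (E := E) l1.tendsto_one).and (hτ0'.1.eventually h2))))).exists
  have hn0 : (0 : ℝ) < n := by exact_mod_cast n3
  have hn1 : (1 : ℝ) ≤ n := by exact_mod_cast n3
  have key := n1 (fun j : ℕ => γ (j * (σ / n)) * ε n * (γ (j * (σ / n)))⁻¹) fun j hj => by
    have hj' : (j : ℝ) ≤ n := by exact_mod_cast hj.le
    have hjσ : (j * (σ / n) : ℝ) ∈ Icc 0 σ := by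
      refine ⟨by positivity, ?_⟩
      rw [mul_div_assoc', div_le_iff₀ hn0, mul_comm]
      gcongr
    have hp : ((n : ℝ) ^ (N + 1)) ≠ 0 := by positivity
    obtain ⟨a1, a2⟩ := n2 _ hjσ (inv_ne_zero hp) (ε n) n4
      (by rw [inv_smul_smul₀ hp, add_sub_cancel])
    refine ⟨a1, hVV ?_⟩
    simp only [inv_inv] at a2
    -- The surplus factor n is removed by balancedness, leaving the power N that `ProductsSmall`
    -- asks for.
    have := hVb.smul_mem (a := (n : ℝ)⁻¹) (by
      rw [Real.norm_eq_abs, abs_of_pos (inv_pos.2 hn0)]; exact inv_le_one_of_one_le₀ hn1) a2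
    rwa [smul_smul, pow_succ', inv_mul_cancel_left₀ hn0.ne'] at this
  rw [hε] at key
  simp only at key
  rw [hγ.prod_conj, mul_div_cancel₀ _ hn0.ne'] at key
  exact ⟨ψ (τ n) ^ n, by simpa using key, H.pow_mem n5 n⟩

/-- For σ = 1/(M+1) small, γ([0, σ]) and its inverses lie in the chart domain. Then γ(1) =
γ(σ)^(M+1), and the closure of H is a subgroup. -/
theorem ProductsSmall.exp_mem_closure (hP : ProductsSmall E G) (hX : IsLeadingIn H X)
    (hγ : IsOneParameterSubgroup γ X) : γ 1 ∈ H.topologicalClosure := by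
  have t1 : Tendsto γ (𝓝 0) (𝓝 1) := hγ.smoothGerm.tendsto
  obtain ⟨r, hr, h⟩ := exists_Ioo_of_eventually ((eventually_mem_source (E := E) t1).and
    (eventually_mem_source (E := E) (tendsto_inv_one t1)))
  obtain ⟨M, hM⟩ := exists_nat_one_div_lt hr
  have hM0 : (0 : ℝ) < M + 1 := by positivity
  have h1 : γ (1 / (M + 1)) ∈ H.topologicalClosure :=
    hP.mem_closure hX hγ (by positivity) fun θ hθ => h θ ⟨by linarith [hθ.1], by linarith [hθ.2]⟩
  have h2 := hγ.map_nat_mul (M + 1) (1 / (M + 1))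
  rw [Nat.cast_succ, mul_one_div_cancel hM0.ne'] at h2
  rw [h2]
  exact pow_mem h1 _

end Exponential

end LCLie

theorem mainTheorem3
    (E : Type*) [AddCommGroup E] [Module ℝ E] [TopologicalSpace E]
    [IsTopologicalAddGroup E] [ContinuousSMul ℝ E] [LocallyConvexSpace ℝ E] [T2Space E]
    (G : Type*) [TopologicalSpace G] [ChartedSpace E G] [Group G] [LCLie.LieGroup E G]
    (H : Subgroup G) :
    (∃ S : Submodule ℝ (LCLie.LieAlg E G), (S : Set (LCLie.LieAlg E G)) = LCLie.tangentSet E H ∧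
      ∀ X ∈ S, ∀ Y ∈ S, LCLie.lieBracket (E := E) (G := G) X Y ∈ S) ∧
    (LCLie.Normable E ∨ LCLie.ContinuousEvolution E G →
      Subgroup.closure ((LCLie.lieExp (E := E) (G := G)) '' LCLie.tangentSet E H)
        ≤ H.topologicalClosure) := by
  refine ⟨LCLie.exists_submodule_tangentSet H, fun h => ?_⟩
  have hP : LCLie.ProductsSmall E G := h.elim (·.productsSmall) (·.productsSmall)
  rw [Subgroup.closure_le]
  rintro _ ⟨X, hX, rfl⟩
  unfold LCLie.lieExp
  split_ifs with hex
  -- The argument applies to any one-parameter subgroup with velocity X, so the choice in `lieExp`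
  -- is immaterial; in the other case the default value 1 lies in the closure trivially.
  · exact hP.exp_mem_closure (LCLie.mem_tangentSet_iff.1 hX) hex.choose_spec
  · exact one_mem _
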